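/- Let $M$ be a connected, orientable smooth 3-manifold, possibly with boundary, and suppose that $H_1(M;\mathbb Z)$ is periodic, i.e. every element of $H_1(M;\mathbb Z)$ has finite order. Let $F$ be a compact smooth surface, possibly with boundary, and let $i\colon F\to M$ be a (proper) generic surface: a smooth map with $i(\partial F)=i(F)\cap\partial M$ such that each value $p\in i(F)$ has a neighborhood in $M$ over which $i$, in suitable smooth coordinates centred at $p$, is a parametrization of one, two or three of the coordinate planes of $\mathbb R^3$ (a regular, double or triple value), or Whitney's umbrella $(s,t)\mapsto(s,t^2,st)$ (a branch value), or, when $p\in\partial M$, one or two of two fixed mutually perpendicular half-planes that are perpendicular to the boundary of a half-space (a regular boundary or double boundary value), each sheet being parametrized exactly once. Suppose that $i$ is equipped with a co-orientation: a choice, continuous in the non-branch points $x\in F$, of a vector in $T_{i(x)}M$ transverse to $Di(T_xF)$ (for example normal to it with respect to a Riemannian metric). Let $M(i)=\overline{\{p\in i(F) : |i^{-1}(p)|>1\}}$. The faces of $i$ are the connected components of $i(F)\setminus M(i)$, and the bodies of $i$ are the connected components of $M\setminus i(F)$. For a face $V$ with bodies $U_1$ and $U_2$ on its two sides (possibly $U_1=U_2$,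 a priori), say that $U_1$ is greater than $U_2$ via $V$ if the co-orientation on $V$ points towards the side of $U_1$. Then $i$ has a choice of winding numbers: one can assign to every body $U$ of $i$ an integer $w(U)$ such that $w(U_1)=w(U_2)+1$ whenever $U_1$ is greater than $U_2$ via some face. -/

import Mathlib

open Set Filter Topology
open scoped Manifold ContDiff

universe u v

/-- The first singular homology group `H₁(X; ℤ)`. (`ULift ℤ` is `ℤ`, placed in the universe
of the space `X`.) -/
noncomputable abbrev IntegralH1 (X : Type u) [TopologicalSpace X] : ModuleCat.{u} ℤ :=
  ((AlgebraicTopology.singularHomologyFunctor (ModuleCat.{u} ℤ) 1).obj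
    (ModuleCat.of ℤ (ULift.{u} ℤ))).obj (TopCat.of X)

/-- The group `H₁(X; ℤ)` is periodic: each of its elements has finite order. -/
def HasPeriodicH1 (X : Type u) [TopologicalSpace X] : Prop :=
  ∀ z : IntegralH1 X, IsOfFinAddOrder z

/-- A smooth 3-manifold (possibly with boundary) is orientable: it is covered by smooth charts
whose transition maps all have positive Jacobian determinant. -/
def IsOrientable3 (M : Type u) [TopologicalSpace M] [ChartedSpace (EuclideanHalfSpace 3) M] :
    Prop :=
  ∃ A ⊆ IsManifold.maximalAtlas (𝓡∂ 3) ∞ M,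
    (∀ x : M, ∃ e ∈ A, x ∈ e.source) ∧
    ∀ e ∈ A, ∀ e' ∈ A, ∀ x ∈ e.source ∩ e'.source,
      0 < (fderivWithin ℝ (e'.extend (𝓡∂ 3) ∘ (e.extend (𝓡∂ 3)).symm) (range (𝓡∂ 3))
        (e.extend (𝓡∂ 3) x)).det

/-! ### The local pictures -/

/-- The parametrized `xy`-plane in `ℝ³`. -/
noncomputable def planeXY (q : EuclideanSpace ℝ (Fin 2)) : EuclideanSpace ℝ (Fin 3) :=
  !₂[q 0, q 1, 0]

/-- The parametrized `xz`-plane in `ℝ³`. -/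
noncomputable def planeXZ (q : EuclideanSpace ℝ (Fin 2)) : EuclideanSpace ℝ (Fin 3) :=
  !₂[q 0, 0, q 1]

/-- The parametrized `yz`-plane in `ℝ³`. -/
noncomputable def planeYZ (q : EuclideanSpace ℝ (Fin 2)) : EuclideanSpace ℝ (Fin 3) :=
  !₂[0, q 0, q 1]

/-- Whitney's umbrella `(s, t) ↦ (s, t², s t)`. -/
noncomputable def whitneyUmbrella (q : EuclideanSpace ℝ (Fin 2)) : EuclideanSpace ℝ (Fin 3) :=
  !₂[q 0, q 1 ^ 2, q 0 * q 1]

/-- A half-plane in the half-space `{x₀ ≥ 0}`, perpendicular to the boundary `{x₀ = 0}`. -/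
noncomputable def halfPlane₁ (q : EuclideanHalfSpace 2) : EuclideanHalfSpace 3 :=
  ⟨planeXY q.1, q.2⟩

/-- Another half-plane in the half-space `{x₀ ≥ 0}`, perpendicular to the boundary and to
`halfPlane₁`. -/
noncomputable def halfPlane₂ (q : EuclideanHalfSpace 2) : EuclideanHalfSpace 3 :=
  ⟨planeXZ q.1, q.2⟩

section GenericSurface

variable {M : Type u} [TopologicalSpace M] [ChartedSpace (EuclideanHalfSpace 3) M]
  {F : Type v} [TopologicalSpace F] [ChartedSpace (EuclideanHalfSpace 2) F]

/-- Around the value `p`, the map `i : F → M` looks like the `k` sheets `g 0, …, g (k - 1)` do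
around the origin: there are smooth coordinates `φ` on an open neighbourhood of `p` in `M`,
centred at `p`, such that the preimage of this neighbourhood is a disjoint union of `k` open
sets with smooth coordinates `ψ j`, in which `i` is the sheet `g j`, restricted to the preimage
of the target of `φ`. -/
def LooksLikeAt {HS HN : Type} [TopologicalSpace HS] [TopologicalSpace HN]
    (J : ModelWithCorners ℝ (EuclideanSpace ℝ (Fin 2)) HS)
    (K : ModelWithCorners ℝ (EuclideanSpace ℝ (Fin 3)) HN)
    {k : ℕ} (g : Fin k → HS → HN) (i : F → M) (p : M) : Prop :=
  ∃ φ : PartialDiffeomorph (𝓡∂ 3) K M HN ∞, p ∈ φ.source ∧ K (φ p) = 0 ∧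
    ∃ ψ : Fin k → PartialDiffeomorph (𝓡∂ 2) J F HS ∞,
      (∀ j j' : Fin k, j ≠ j' → Disjoint (ψ j).source (ψ j').source) ∧
      i ⁻¹' φ.source = ⋃ j, (ψ j).source ∧
      ∀ j, (ψ j).target = g j ⁻¹' φ.target ∧ ∀ x ∈ (ψ j).source, φ (i x) = g j (ψ j x)

/-- A regular value: one sheet. -/
def IsRegularValue (i : F → M) (p : M) : Prop :=
  LooksLikeAt (𝓡 2) (𝓡 3) ![planeXY] i p

/-- A double value: two transverse sheets. -/
def IsDoubleValue (i : F → M) (p : M) : Prop :=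
  LooksLikeAt (𝓡 2) (𝓡 3) ![planeXY, planeXZ] i p

/-- A triple value: three transverse sheets. -/
def IsTripleValue (i : F → M) (p : M) : Prop :=
  LooksLikeAt (𝓡 2) (𝓡 3) ![planeXY, planeXZ, planeYZ] i p

/-- A branch value: the cross-cap. -/
def IsBranchValue (i : F → M) (p : M) : Prop :=
  LooksLikeAt (𝓡 2) (𝓡 3) ![whitneyUmbrella] i p

/-- A regular boundary (RB) value: one sheet, transverse to the boundary of `M`. -/
def IsRegularBoundaryValue (i : F → M) (p : M) : Prop :=
  LooksLikeAt (𝓡∂ 2) (𝓡∂ 3) ![halfPlane₁] i p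

/-- A double boundary (DB) value: two transverse sheets, transverse to the boundary of `M`. -/
def IsDoubleBoundaryValue (i : F → M) (p : M) : Prop :=
  LooksLikeAt (𝓡∂ 2) (𝓡∂ 3) ![halfPlane₁, halfPlane₂] i p

/-- A (proper) generic surface: a smooth map from the surface `F` (compactness of `F` is
assumed separately) to the 3-manifold `M`, each of whose values is of one of the six types. -/
structure IsGenericSurface (i : F → M) : Prop where
  smooth : ContMDiff (𝓡∂ 2) (𝓡∂ 3) ∞ i
  proper : i '' (𝓡∂ 2).boundary F = range i ∩ (𝓡∂ 3).boundary M
  values : ∀ p ∈ range i,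
    IsRegularValue i p ∨ IsDoubleValue i p ∨ IsTripleValue i p ∨ IsBranchValue i p ∨
      IsRegularBoundaryValue i p ∨ IsDoubleBoundaryValue i p

/-- A co-orientation: a choice, continuous in the point `x` of `F` as long as `x` is not a
branch point (that is, as long as `i` is an immersion at `x`), of a vector at `i x` that is
transverse to the sheet of `i` at `x`. The values of `ν` at branch points are irrelevant. -/
structure IsCoorientation [IsManifold (𝓡∂ 3) ∞ M] (i : F → M)
    (ν : ∀ x : F, TangentSpace (𝓡∂ 3) (i x)) : Prop where
  continuousOn : ContinuousOn (fun x => (⟨i x, ν x⟩ : TangentBundle (𝓡∂ 3) M))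
    {x | Function.Injective (mfderiv (𝓡∂ 2) (𝓡∂ 3) i x)}
  transverse : ∀ x, Function.Injective (mfderiv (𝓡∂ 2) (𝓡∂ 3) i x) →
    ν x ∉ range (mfderiv (𝓡∂ 2) (𝓡∂ 3) i x)

/-- The intersection graph: the closure of the set of values with more than one preimage. -/
def intersectionGraph (i : F → M) : Set M :=
  closure {p | (i ⁻¹' {p}).Nontrivial}

/-- A face: a connected component of the image minus the intersection graph. -/
def IsFace (i : F → M) (V : Set M) : Prop :=
  ∃ p ∈ range i \ intersectionGraph i,
    V = connectedComponentIn (range i \ intersectionGraph i) p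

/-- A body: a connected component of the complement of the image. -/
def IsBody (i : F → M) (U : Set M) : Prop :=
  ∃ p ∈ (range i)ᶜ, U = connectedComponentIn (range i)ᶜ p

/-- `U₁` and `U₂` are the bodies on the two sides of the face `V`, and the arrows of the
co-orientation on `V` point towards `U₁`: some curve that crosses `V` with the velocity given by
the arrow comes from `U₂` and goes to `U₁`. -/
def IsGreaterVia (i : F → M) (ν : ∀ x : F, TangentSpace (𝓡∂ 3) (i x)) (V U₁ U₂ : Set M) :
    Prop :=
  ∃ x : F, i x ∈ V ∧ ∃ γ : ℝ → M, MDifferentiableAt 𝓘(ℝ, ℝ) (𝓡∂ 3) γ 0 ∧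
    (⟨γ 0, mfderiv 𝓘(ℝ, ℝ) (𝓡∂ 3) γ 0 (1 : ℝ)⟩ : TangentBundle (𝓡∂ 3) M) = ⟨i x, ν x⟩ ∧
    (∀ᶠ t in 𝓝[>] (0 : ℝ), γ t ∈ U₁) ∧ (∀ᶠ t in 𝓝[<] (0 : ℝ), γ t ∈ U₂)

/-- A choice of winding numbers: an integer for every body, which increases by one across each
face in the direction of the co-orientation. -/
def IsWindingNumbers (i : F → M) (ν : ∀ x : F, TangentSpace (𝓡∂ 3) (i x))
    (w : {U : Set M // IsBody i U} → ℤ) : Prop :=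
  ∀ (V : Set M) (U₁ U₂ : {U : Set M // IsBody i U}), IsFace i V →
    IsGreaterVia i ν V U₁.1 U₂.1 → w U₁ = w U₂ + 1

end GenericSurface

/-! Winding numbers always exist locally, and the obstruction to a global choice is a class in
`H¹(M; ℤ) = Hom(H₁(M; ℤ), ℤ)`, which vanishes because a homomorphism from a torsion group to `ℤ` is
zero.

Local existence (`IsGenericSurface.exists_isLocalWinding`): in a small cube the immersed part of
each sheet is connected, so the co-orientation has a constant sign against a fixed normal covector.
An explicit integer function then jumps correctly: for planes, count the sheets on whose positive
side a point lies; for the umbrella, give its two lobes opposite values and the outside zero.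

Local uniqueness (`IsGenericSurface.eventually_sub_eq`): two local winding numbers jump equally
across each regular sheet, so their difference extends over such sheets as a locally constant
function. The remaining bad set lies, in coordinates, in the coordinate axes, whose codimension two
leaves the cube connected.

Gluing (`exists_glued_function`): the differences of local winding numbers form an integral Čech
1-cocycle. It defines a covering space with fibre `ℤ`; lifting simplices turns it into a singular
1-cocycle, which respects concatenation of paths because `H₁` is torsion
(`HasPeriodicH1.cocycle_add`). Integrating along paths from a base point trivializes it
(`IntCocycle.exists_coboundary`). The corrected function is constant on bodies and jumps by one
across faces. -/

/-! ### Integral 1-cocycles on spaces with torsion first homology -/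

-- The chain `e₁ + e₂ - e₃` is a cycle, so a positive multiple of it is a boundary. A cocycle kills
-- boundaries, and `ℤ` has no torsion, so the cocycle already kills the cycle itself.
open CategoryTheory Limits Simplicial in
theorem SSet.cocycle_add_of_isOfFinAddOrder (S : SSet.{u}) (c : S _⦋1⦌ → ℤ)
    (hc : ∀ t : S _⦋2⦌, c (S.δ 0 t) - c (S.δ 1 t) + c (S.δ 2 t) = 0)
    (hper : ∀ z : (SSet.chainComplex S (ModuleCat.of ℤ (ULift.{u} ℤ))).homology 1,
      IsOfFinAddOrder z)
    (e₁ e₂ e₃ : S _⦋1⦌) (h₁₂ : S.δ 0 e₁ = S.δ 1 e₂) (h₁₃ : S.δ 1 e₁ = S.δ 1 e₃)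
    (h₂₃ : S.δ 0 e₂ = S.δ 0 e₃) : c e₁ + c e₂ = c e₃ := by
  set R : ModuleCat.{u} ℤ := ModuleCat.of ℤ (ULift.{u} ℤ)
  let K := SSet.chainComplex S R
  obtain ⟨φ, hφ⟩ : ∃ φ : K.X 1 ⟶ R, ∀ s, S.ιChainComplex s ≫ φ = c s • 𝟙 R :=
    ⟨(S.isColimitChainComplexXCofan R 1).desc (Cofan.mk _ fun s => c s • 𝟙 R),
      fun s => (S.isColimitChainComplexXCofan R 1).fac (Cofan.mk _ fun s => c s • 𝟙 R) ⟨s⟩⟩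
  let k : R ⟶ K.X 1 := S.ιChainComplex e₁ + S.ιChainComplex e₂ - S.ιChainComplex e₃
  have hk : k ≫ K.d 1 0 = 0 := by
    have hd : ∀ e : S _⦋1⦌, S.ιChainComplex e ≫ K.d 1 0 =
        S.ιChainComplex (S.δ 0 e) - S.ιChainComplex (S.δ 1 e) := fun e =>
      ((SSet.ιChainComplex_d S R e).trans (Fin.sum_univ_two _)).trans (by simp [sub_eq_add_neg])
    simp only [k, Preadditive.sub_comp, Preadditive.add_comp, hd, h₁₂, h₁₃, h₂₃]
    abel
  have hdφ : K.d 2 1 ≫ φ = 0 := by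
    apply SSet.chainComplex_hom_ext
    intro t
    have := hc t
    have hd : S.ιChainComplex t ≫ K.d 2 1 = S.ιChainComplex (S.δ 0 t) -
        S.ιChainComplex (S.δ 1 t) + S.ιChainComplex (S.δ 2 t) :=
      ((SSet.ιChainComplex_d S R t).trans (Fin.sum_univ_three _)).trans (by simp [sub_eq_add_neg])
    rw [reassoc_of% hd, comp_zero]
    simp only [Preadditive.add_comp, Preadditive.sub_comp, hφ, ← sub_smul, ← add_smul, this,
      zero_smul]
  -- `κ` is the homology class of the cycle `k`, and `ψ` is the functional that `φ` induces on
  -- homology; their composite is evaluation of `φ` on `k`.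
  let κ := K.liftCycles k 0 (by simp) hk ≫ K.homologyπ 1
  let ψ := K.homologyι 1 ≫ K.descOpcycles φ 2 (by simp) hdφ
  have hκψ : κ ≫ ψ = k ≫ φ := by
    simp [κ, ψ]
  have hk' : k ≫ φ = (c e₁ + c e₂ - c e₃) • 𝟙 R := by
    simp only [k, Preadditive.add_comp, Preadditive.sub_comp, hφ, add_smul, sub_smul]
  obtain ⟨N, hN, hN'⟩ := isOfFinAddOrder_iff_nsmul_eq_zero.1 (hper (κ (ULift.up 1)))
  have h := congrArg ψ hN'
  rw [map_nsmul, map_zero, ← ConcreteCategory.comp_apply, hκψ, hk'] at h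
  have h' : N • ((c e₁ + c e₂ - c e₃) • (1 : ℤ)) = 0 := congrArg ULift.down h
  have : (N : ℤ) * (c e₁ + c e₂ - c e₃) = 0 := by simpa using h'
  have hN0 : (N : ℤ) ≠ 0 := by exact_mod_cast hN.ne'
  have := (mul_eq_zero.1 this).resolve_left hN0
  omega

/-- The inclusion of the `i`-th face of the standard simplex. -/
noncomputable def stdSimplexFace {n : ℕ} (i : Fin (n + 2)) :
    C(stdSimplex ℝ (Fin (n + 1)), stdSimplex ℝ (Fin (n + 2))) :=
  ⟨stdSimplex.map i.succAbove, stdSimplex.continuous_map _⟩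

theorem TopCat.toSSetObjEquiv_δ (X : TopCat.{u}) {n : ℕ} (i : Fin (n + 2))
    (s : (TopCat.toSSet.obj X).obj (.op (.mk (n + 1)))) :
    X.toSSetObjEquiv (.op (.mk n)) ((TopCat.toSSet.obj X).δ i s) =
      (X.toSSetObjEquiv (.op (.mk (n + 1))) s).comp (stdSimplexFace i) := by
  rfl

theorem HasPeriodicH1.cocycle_add {X : Type u} [TopologicalSpace X] (hX : HasPeriodicH1 X)
    (c : C(stdSimplex ℝ (Fin 2), X) → ℤ)
    (hc : ∀ t : C(stdSimplex ℝ (Fin 3), X), c (t.comp (stdSimplexFace 0)) -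
      c (t.comp (stdSimplexFace 1)) + c (t.comp (stdSimplexFace 2)) = 0)
    (e₁ e₂ e₃ : C(stdSimplex ℝ (Fin 2), X))
    (h₁₂ : e₁ (stdSimplex.vertex 1) = e₂ (stdSimplex.vertex 0))
    (h₁₃ : e₁ (stdSimplex.vertex 0) = e₃ (stdSimplex.vertex 0))
    (h₂₃ : e₂ (stdSimplex.vertex 1) = e₃ (stdSimplex.vertex 1)) : c e₁ + c e₂ = c e₃ := by
  let Y := TopCat.of X
  let Φ := Y.toSSetObjEquiv (.op (.mk 1))
  have key := SSet.cocycle_add_of_isOfFinAddOrder (TopCat.toSSet.obj Y) (fun s => c (Φ s))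
    (fun t => hc (Y.toSSetObjEquiv (.op (.mk 2)) t)) hX (Φ.symm e₁) (Φ.symm e₂) (Φ.symm e₃)
  have hδ : ∀ (e e' : C(stdSimplex ℝ (Fin 2), X)) (j j' : Fin 2),
      e (stdSimplex.vertex (j.succAbove 0)) = e' (stdSimplex.vertex (j'.succAbove 0)) →
      (TopCat.toSSet.obj Y).δ j (Φ.symm e) = (TopCat.toSSet.obj Y).δ j' (Φ.symm e') := by
    intro e e' j j' h
    apply (Y.toSSetObjEquiv (.op (.mk 0))).injective
    rw [TopCat.toSSetObjEquiv_δ, TopCat.toSSetObjEquiv_δ]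
    have : ∀ (e : C(stdSimplex ℝ (Fin 2), X)) (j : Fin 2) (a : stdSimplex ℝ (Fin 1)),
        (Φ (Φ.symm e)).comp (stdSimplexFace j) a = e (stdSimplex.vertex (j.succAbove 0)) := by
      intro e j a
      rw [Equiv.apply_symm_apply, Subsingleton.elim a (stdSimplex.vertex 0)]
      simp [stdSimplexFace]
    ext a
    exact (this e j a).trans (h.trans (this e' j' a).symm)
  simpa using key (hδ _ _ _ _ h₁₂) (hδ _ _ _ _ h₁₃) (hδ _ _ _ _ h₂₃)

/-! ### Integral Čech cocycles and their covering spaces -/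

instance {ι : Type*} [Fintype ι] : LocallyPathConnectedSpace (stdSimplex ℝ ι) :=
  (convex_stdSimplex ℝ ι).locallyPathConnectedSpace

instance {ι : Type*} [Fintype ι] [Nonempty ι] : SimplyConnectedSpace (stdSimplex ℝ ι) :=
  have : ContractibleSpace (stdSimplex ℝ ι) := (convex_stdSimplex ℝ ι).contractibleSpace
    (Set.nonempty_coe_sort.1 inferInstance)
  inferInstance

section Cover

variable {X : Type u} [TopologicalSpace X]

/-- An integral Čech 1-cocycle on an open cover of `X` indexed by the points of `X`. -/
structure IntCocycle (X : Type u) [TopologicalSpace X] where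
  /-- The cover. -/
  U : X → Set X
  /-- The transition functions. -/
  d : X → X → X → ℤ
  isOpen : ∀ p, IsOpen (U p)
  mem : ∀ p, p ∈ U p
  locConst : ∀ p q, ∀ x ∈ U p ∩ U q, ∀ᶠ y in 𝓝 x, d p q y = d p q x
  add : ∀ p q r, ∀ x ∈ U p ∩ U q ∩ U r, d p q x + d q r x = d p r x

namespace IntCocycle

variable (D : IntCocycle X)

theorem self (p : X) {x : X} (hx : x ∈ D.U p) : D.d p p x = 0 := by
  have := D.add p p p x ⟨⟨hx, hx⟩, hx⟩
  omega

/-- The principal `ℤ`-bundle of a cocycle. -/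
def bundle : FiberBundleCore X X ℤ where
  baseSet := D.U
  isOpen_baseSet := D.isOpen
  indexAt := id
  mem_baseSet_at := D.mem
  coordChange p q x n := n + D.d p q x
  coordChange_self p x hx n := by simp [D.self p hx]
  continuousOn_coordChange p q := by
    rintro ⟨x, n⟩ ⟨hx, -⟩
    apply ContinuousAt.continuousWithinAt
    apply ContinuousAt.add continuousAt_snd
    refine ContinuousAt.comp (x := (x, n)) (f := Prod.fst) (g := D.d p q) ?_ continuousAt_fst
    exact (continuousAt_const (y := D.d p q x)).congr
      ((D.locConst p q x hx).mono fun y hy => hy.symm)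
  coordChange_comp p q r x hx n := by
    rw [← D.add p q r x hx]
    ring

theorem isCoveringMap : IsCoveringMap D.bundle.proj :=
  FiberBundle.isCoveringMap (E := D.bundle.Fiber)

/-- The value of a point of the bundle in the trivialization at its base point. -/
def height (e : D.bundle.TotalSpace) : ℤ := e.2

/-- The height need not be locally constant, since each point is read in its own chart. Transported
to one fixed chart it becomes continuous with values in the discrete space `ℤ`. -/
theorem eventually_height {A : Type*} [TopologicalSpace A] {g : A → D.bundle.TotalSpace}
    (hg : Continuous g) (q : X) (a : A) (ha : (g a).1 ∈ D.U q) : ∀ᶠ b in 𝓝 a,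
      D.height (g b) + D.d (g b).1 q (g b).1 = D.height (g a) + D.d (g a).1 q (g a).1 := by
  have h1 : ContinuousAt (fun b => (D.bundle.localTriv q (g b)).2) a := by
    refine continuousAt_snd.comp (ContinuousAt.comp ?_ hg.continuousAt)
    exact (D.bundle.localTriv q).continuousOn.continuousAt
      ((D.bundle.localTriv q).open_source.mem_nhds
        ((D.bundle.mem_localTriv_source _ _).2 ha))
  exact h1 (IsOpen.mem_nhds (isOpen_discrete {_}) rfl)

/-- The transport to a fixed chart adds the same integer to both lifts and cancels in the
difference. This makes `increment` independent of the lift. -/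
theorem height_sub_height {A : Type*} [TopologicalSpace A] [PreconnectedSpace A]
    {g g' : A → D.bundle.TotalSpace} (hg : Continuous g) (hg' : Continuous g')
    (h : ∀ a, (g a).1 = (g' a).1) (a b : A) :
    D.height (g a) - D.height (g' a) = D.height (g b) - D.height (g' b) := by
  have : IsLocallyConstant fun a => D.height (g a) - D.height (g' a) := by
    rw [IsLocallyConstant.iff_eventually_eq]
    intro a
    filter_upwards [D.eventually_height hg (g a).1 a (D.mem _),
      D.eventually_height hg' (g a).1 a (h a ▸ D.mem _)] with b hb hb'
    rw [← h, ← h] at hb'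
    omega
  exact this.apply_eq_of_preconnectedSpace a b

theorem exists_lift {A : Type*} [TopologicalSpace A] [SimplyConnectedSpace A]
    [LocallyPathConnectedSpace A] (f : C(A, X)) :
    ∃ g : C(A, D.bundle.TotalSpace), ∀ a, (g a).1 = f a := by
  obtain ⟨a⟩ : Nonempty A := inferInstance
  obtain ⟨g, ⟨-, hg⟩, -⟩ := D.isCoveringMap.existsUnique_continuousMap_lifts f a
    ⟨f a, (0 : ℤ)⟩ rfl
  exact ⟨g, fun a => congrFun hg a⟩

/-- The increment of the cocycle along a singular 1-simplex. -/
noncomputable def increment (s : C(stdSimplex ℝ (Fin 2), X)) : ℤ :=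
  D.height ((D.exists_lift s).choose (stdSimplex.vertex 1)) -
    D.height ((D.exists_lift s).choose (stdSimplex.vertex 0))

theorem increment_eq (g : C(stdSimplex ℝ (Fin 2), D.bundle.TotalSpace))
    (s : C(stdSimplex ℝ (Fin 2), X)) (h : ∀ a, (g a).1 = s a) :
    D.increment s =
      D.height (g (stdSimplex.vertex 1)) - D.height (g (stdSimplex.vertex 0)) := by
  have h' := (D.exists_lift s).choose_spec
  have := D.height_sub_height (D.exists_lift s).choose.continuous g.continuous
    (fun a => (h' a).trans (h a).symm) (stdSimplex.vertex 0) (stdSimplex.vertex 1)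
  rw [increment]
  omega

/-- One lift of the whole triangle restricts to lifts of its three edges, and the height differences
telescope. -/
theorem increment_boundary (t : C(stdSimplex ℝ (Fin 3), X)) :
    D.increment (t.comp (stdSimplexFace 0)) - D.increment (t.comp (stdSimplexFace 1)) +
      D.increment (t.comp (stdSimplexFace 2)) = 0 := by
  obtain ⟨g, hg⟩ := D.exists_lift t
  have key : ∀ j : Fin 3, D.increment (t.comp (stdSimplexFace j)) =
      D.height (g (stdSimplex.vertex (j.succAbove 1))) -
        D.height (g (stdSimplex.vertex (j.succAbove 0))) := by
    intro j
    rw [D.increment_eq (g.comp (stdSimplexFace j)) _ fun a => hg _]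
    simp [stdSimplexFace]
  have h0 : (0 : Fin 3).succAbove (1 : Fin 2) = 2 ∧ (0 : Fin 3).succAbove (0 : Fin 2) = 1 ∧
    (1 : Fin 3).succAbove (1 : Fin 2) = 2 ∧ (1 : Fin 3).succAbove (0 : Fin 2) = 0 ∧
    (2 : Fin 3).succAbove (1 : Fin 2) = 1 ∧ (2 : Fin 3).succAbove (0 : Fin 2) = 0 := by decide
  simp only [key, h0]
  ring

end IntCocycle

/-- A singular 1-simplex from a path. -/
noncomputable def Path.toSimplex {x y : X} (γ : Path x y) : C(stdSimplex ℝ (Fin 2), X) :=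
  γ.toContinuousMap.comp ⟨_, stdSimplexHomeomorphUnitInterval.continuous⟩

theorem Path.toSimplex_vertex_zero {x y : X} (γ : Path x y) :
    γ.toSimplex (stdSimplex.vertex 0) = x := by
  have : stdSimplexHomeomorphUnitInterval (stdSimplex.vertex 0) = 0 :=
    stdSimplexHomeomorphUnitInterval_zero
  simp [toSimplex, this]

theorem Path.toSimplex_vertex_one {x y : X} (γ : Path x y) :
    γ.toSimplex (stdSimplex.vertex 1) = y := by
  have : stdSimplexHomeomorphUnitInterval (stdSimplex.vertex 1) = 1 :=
    stdSimplexHomeomorphUnitInterval_one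
  simp [toSimplex, this]

/-- On a space with periodic `H₁`, every integral cocycle is a coboundary. -/
theorem IntCocycle.exists_coboundary [PathConnectedSpace X] [LocallyPathConnectedSpace X]
    (hX : HasPeriodicH1 X) (D : IntCocycle X) :
    ∃ w : X → ℤ, ∀ q, ∃ n, ∀ᶠ y in 𝓝 q, w y + D.d y q y = n := by
  obtain ⟨x₀⟩ : Nonempty X := inferInstance
  let γ : ∀ x, Path x₀ x := fun x => PathConnectedSpace.somePath x₀ x
  refine ⟨fun x => D.increment (γ x).toSimplex, fun q => ?_⟩
  have hadd := hX.cocycle_add D.increment D.increment_boundary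
  obtain ⟨V, ⟨hVq, hV⟩, hVU⟩ := (path_connected_basis q).mem_iff.1
    ((D.isOpen q).mem_nhds (D.mem q))
  refine ⟨D.increment (γ q).toSimplex, ?_⟩
  filter_upwards [hVq] with y hy
  obtain ⟨δ, hδ⟩ := hV.joinedIn q (mem_of_mem_nhds hVq) y hy
  have h := hadd (γ q).toSimplex δ.toSimplex (γ y).toSimplex
    (by simp only [Path.toSimplex_vertex_one, Path.toSimplex_vertex_zero])
    (by simp only [Path.toSimplex_vertex_zero]) (by simp only [Path.toSimplex_vertex_one])
  have hmem : ∀ a, δ.toSimplex a ∈ D.U q := fun a => hVU (hδ (stdSimplexHomeomorphUnitInterval a))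
  -- Inside the chart at `q` the zero section is a lift of `δ`, so the increment along `δ` can be
  -- read off from the transition functions.
  let g : C(stdSimplex ℝ (Fin 2), D.bundle.TotalSpace) :=
    ⟨fun a => (D.bundle.localTriv q).toOpenPartialHomeomorph.symm (δ.toSimplex a, 0), by
      refine (D.bundle.localTriv q).toOpenPartialHomeomorph.continuousOn_symm.comp_continuous
        (by fun_prop) fun a => ?_
      exact (D.bundle.mem_localTriv_target _ _).2 (hmem a)⟩
  have hg : ∀ a, D.height (g a) = D.d q (δ.toSimplex a) (δ.toSimplex a) := fun a =>
    zero_add _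
  have hinc := D.increment_eq g δ.toSimplex fun a => rfl
  rw [hg, hg, Path.toSimplex_vertex_zero, Path.toSimplex_vertex_one, D.self q (D.mem q)] at hinc
  have hy' : y ∈ D.U q := hVU hy
  have h2 := D.add q y q y ⟨⟨hy', D.mem y⟩, hy'⟩
  rw [D.self q hy'] at h2
  show D.increment _ + _ = _
  omega

end Cover

/-! ### Gluing local functions up to constants -/

open Classical in
/-- Local functions on a dense set whose differences are locally constant glue, up to local
constants, to a global function on a space with periodic `H₁`. -/
theorem exists_glued_function {X : Type u} [TopologicalSpace X] [PathConnectedSpace X]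
    [LocallyPathConnectedSpace X] (hX : HasPeriodicH1 X) {C : Set X} (hC : Dense C)
    (U : X → Set X) (f : X → X → ℤ) (hU : ∀ p, IsOpen (U p)) (hmem : ∀ p, p ∈ U p)
    (hf : ∀ p q, ∀ x ∈ U p ∩ U q, ∃ c, ∀ᶠ y in 𝓝[C] x, f p y - f q y = c) :
    ∃ w : X → ℤ, ∀ q, ∃ n, ∀ᶠ y in 𝓝[C] q, w y = f q y + n := by
  -- The value at `x` is the germ of `f p - f q` along `C`, unique because `C` is dense. The default
  -- 0 matters only off the overlaps, where nothing is required.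
  let d : X → X → X → ℤ := fun p q x =>
    if h : ∃ c, ∀ᶠ y in 𝓝[C] x, f p y - f q y = c then h.choose else 0
  have hd : ∀ p q, ∀ x ∈ U p ∩ U q, ∀ᶠ y in 𝓝[C] x, f p y - f q y = d p q x := by
    intro p q x hx
    have h := hf p q x hx
    simp only [d, dif_pos h]
    exact h.choose_spec
  have hne : ∀ x, (𝓝[C] x).NeBot := fun x => mem_closure_iff_nhdsWithin_neBot.1 (hC x)
  have huniq : ∀ p q x c, x ∈ U p ∩ U q → (∀ᶠ y in 𝓝[C] x, f p y - f q y = c) →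
      d p q x = c := by
    intro p q x c hx h
    have := hne x
    obtain ⟨y, h1, h2⟩ := ((hd p q x hx).and h).exists
    exact h1.symm.trans h2
  have hlc : ∀ p q, ∀ x ∈ U p ∩ U q, ∀ᶠ y in 𝓝 x, d p q y = d p q x := by
    intro p q x hx
    have h1 := eventually_eventually_nhds.2 (eventually_nhdsWithin_iff.1 (hd p q x hx))
    filter_upwards [h1, ((hU p).inter (hU q)).mem_nhds hx] with y hy hy'
    exact huniq p q y _ hy' (eventually_nhdsWithin_iff.2 hy)
  let D : IntCocycle X :=
    { U := U
      d := d
      isOpen := hU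
      mem := hmem
      locConst := hlc
      add := by
        rintro p q r x ⟨⟨hp, hq⟩, hr⟩
        refine (huniq p r x _ ⟨hp, hr⟩ ?_).symm
        filter_upwards [hd p q x ⟨hp, hq⟩, hd q r x ⟨hq, hr⟩] with y h1 h2
        rw [← h1, ← h2]
        ring }
  obtain ⟨w, hw⟩ := D.exists_coboundary hX
  -- At a point `y` of `C` near `q`, `f y y = f q y + d y q y`, and `w y + d y q y` is the constant
  -- `n`.
  refine ⟨fun y => w y + f y y, fun q => ?_⟩
  obtain ⟨n, hn⟩ := hw q
  refine ⟨n, ?_⟩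
  filter_upwards [mem_nhdsWithin_of_mem_nhds hn, self_mem_nhdsWithin,
    mem_nhdsWithin_of_mem_nhds ((hU q).mem_nhds (hmem q))] with y hy hyC hyU
  have h1 : f y y - f q y = d y q y := (hd y q y ⟨hmem y, hyU⟩).self_of_nhdsWithin hyC
  have hy' : w y + d y q y = n := hy
  omega

/-! ### Model sheets: coordinate planes and Whitney's umbrella -/

theorem HasDerivAt.eventually_pos_neg {f : ℝ → ℝ} {f' : ℝ} (hf : HasDerivAt f f' 0)
    (h0 : f 0 = 0) (hf' : 0 < f') :
    (∀ᶠ t in 𝓝[>] (0 : ℝ), 0 < f t) ∧ ∀ᶠ t in 𝓝[<] (0 : ℝ), f t < 0 := by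
  have h := eventually_nhdsWithin_sign_eq_of_deriv_pos (by rwa [hf.deriv]) h0
  constructor
  · filter_upwards [mem_nhdsWithin_of_mem_nhds h, self_mem_nhdsWithin] with t ht ht0
    rwa [sub_zero, _root_.sign_pos (mem_Ioi.1 ht0), sign_eq_one_iff] at ht
  · filter_upwards [mem_nhdsWithin_of_mem_nhds h, self_mem_nhdsWithin] with t ht ht0
    rwa [sub_zero, _root_.sign_neg (mem_Iio.1 ht0), sign_eq_neg_one_iff] at ht

/-- The plane, or the half-plane `{q₀ ≥ 0}` if `h` holds. -/
def paramDomain (h : Prop) : Set (EuclideanSpace ℝ (Fin 2)) := {q | h → 0 ≤ q 0}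

/-- The space, or the half-space `{v₀ ≥ 0}` if `h` holds. -/
def modelDomain (h : Prop) : Set (EuclideanSpace ℝ (Fin 3)) := {v | h → 0 ≤ v 0}

/-- The open cube of side `2 ε`, centred at the origin. -/
def openCube (ε : ℝ) : Set (EuclideanSpace ℝ (Fin 3)) := {v | ∀ a, |v a| < ε}

/-- The union of the coordinate axes. -/
def coordAxes : Set (EuclideanSpace ℝ (Fin 3)) := {v | ∃ a b, a ≠ b ∧ v a = 0 ∧ v b = 0}

theorem isOpen_openCube (ε : ℝ) : IsOpen (openCube ε) := by
  simp only [openCube, ofPred_forall]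
  exact isOpen_iInter_of_finite fun a => isOpen_lt (by fun_prop) continuous_const

theorem convex_openCube (ε : ℝ) : Convex ℝ (openCube ε) := by
  intro v hv w hw s t hs ht hst a
  have := (convex_ball (0 : ℝ) ε) (mem_ball_zero_iff.2 (hv a)) (mem_ball_zero_iff.2 (hw a)) hs ht hst
  simpa using this

theorem convex_modelDomain (h : Prop) : Convex ℝ (modelDomain h) := by
  intro v hv w hw s t hs ht hst hh
  have h1 := hv hh
  have h2 := hw hh
  simp only [PiLp.add_apply, PiLp.smul_apply, smul_eq_mul]
  positivity

theorem convex_paramDomain (h : Prop) : Convex ℝ (paramDomain h) := by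
  intro v hv w hw s t hs ht hst hh
  have h1 := hv hh
  have h2 := hw hh
  simp only [PiLp.add_apply, PiLp.smul_apply, smul_eq_mul]
  positivity

theorem isClosed_coordAxes : IsClosed coordAxes := by
  have : coordAxes = ⋃ a, ⋃ b, {v | a ≠ b ∧ v a = 0 ∧ v b = 0} := by
    ext v
    simp [coordAxes]
  rw [this]
  refine isClosed_iUnion_of_finite fun a => isClosed_iUnion_of_finite fun b => ?_
  exact isClosed_const.and ((isClosed_eq (by fun_prop) continuous_const).and
    (isClosed_eq (by fun_prop) continuous_const))

theorem exists_openCube_subset {s : Set (EuclideanSpace ℝ (Fin 3))} (hs : s ∈ 𝓝 0) :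
    ∃ ε, 0 < ε ∧ ε ≤ 1 ∧ openCube ε ⊆ s := by
  obtain ⟨r, hr, hrs⟩ := Metric.mem_nhds_iff.1 hs
  refine ⟨min 1 (r / 2), by positivity, min_le_left _ _, fun v hv => hrs ?_⟩
  rw [mem_ball_zero_iff, EuclideanSpace.norm_eq, Real.sqrt_lt' hr, Fin.sum_univ_three]
  have : ∀ a, ‖v a‖ ^ 2 < (r / 2) ^ 2 := fun a =>
    pow_lt_pow_left₀ ((hv a).trans_le (min_le_right _ _)) (abs_nonneg _) two_ne_zero
  nlinarith [this 0, this 1, this 2]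

theorem zero_mem_openCube {ε : ℝ} (hε : 0 < ε) : (0 : EuclideanSpace ℝ (Fin 3)) ∈ openCube ε :=
  fun a => by simpa using hε

/-- The values with several preimages of a family of parametrized sheets. -/
def doubleValues (h : Prop) {k : ℕ}
    (P : Fin k → EuclideanSpace ℝ (Fin 2) → EuclideanSpace ℝ (Fin 3)) :
    Set (EuclideanSpace ℝ (Fin 3)) :=
  {v | v ∈ modelDomain h ∧ ∃ a b : Fin k × EuclideanSpace ℝ (Fin 2), a ≠ b ∧
    a.2 ∈ paramDomain h ∧ b.2 ∈ paramDomain h ∧ P a.1 a.2 = v ∧ P b.1 b.2 = v}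

/-- A local picture of sheets near the origin of the space (or half-space), together with
a function that jumps by one when a sheet is crossed in a prescribed direction. -/
structure SheetModel (h : Prop) (k : ℕ) where
  /-- The parametrizations of the sheets. -/
  P : Fin k → EuclideanSpace ℝ (Fin 2) → EuclideanSpace ℝ (Fin 3)
  /-- Their derivatives. -/
  D : Fin k → EuclideanSpace ℝ (Fin 2) → EuclideanSpace ℝ (Fin 2) →L[ℝ] EuclideanSpace ℝ (Fin 3)
  hasFDerivAt : ∀ j q, HasFDerivAt (P j) (D j q) q
  /-- The parameters at which the sheet is immersed. -/
  Q : Fin k → Set (EuclideanSpace ℝ (Fin 2))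
  injective_D : ∀ j, ∀ q ∈ Q j, Function.Injective (D j q)
  /-- A normal covector. -/
  n : Fin k → EuclideanSpace ℝ (Fin 2) → EuclideanSpace ℝ (Fin 3) →L[ℝ] ℝ
  continuous_n : ∀ j, Continuous (n j)
  n_ne_zero : ∀ j, ∀ q ∈ Q j, n j q ≠ 0
  n_D : ∀ j q u, n j q (D j q u) = 0
  -- Connectedness of the immersed part lets one sign describe the co-orientation along a whole
  -- sheet.
  preconnected : ∀ j ε, 0 < ε → ε ≤ 1 →
    IsPreconnected {q | q ∈ paramDomain h ∧ q ∈ Q j ∧ P j q ∈ openCube ε}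
  doubleValues_subset : doubleValues h P ⊆ coordAxes
  -- These points tend to the origin inside the model domain and show that the complement of the
  -- sheets accumulates there.
  diag : ∀ δ : ℝ, 0 < δ → ∀ j q, P j q ≠ !₂[δ, -δ, δ]
  /-- The jumping function, for given signs of the sheets. -/
  step : (Fin k → ℤ) → EuclideanSpace ℝ (Fin 3) → ℤ
  step_eventually : ∀ s, ∀ v ∈ modelDomain h, (∀ j, ∀ q ∈ paramDomain h, P j q ≠ v) →
    ∀ᶠ w in 𝓝 v, step s w = step s v
  mem_Q : ∀ j, ∀ q ∈ paramDomain h, P j q ∉ closure (doubleValues h P) → q ∈ Q j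
  step_jump : ∀ s : Fin k → ℤ, (∀ j, s j = 1 ∨ s j = -1) → ∀ j, ∀ q ∈ paramDomain h,
    P j q ∈ modelDomain h → P j q ∉ closure (doubleValues h P) →
    ∀ (c : ℝ → EuclideanSpace ℝ (Fin 3)) (c' : EuclideanSpace ℝ (Fin 3)), HasDerivAt c c' 0 →
      c 0 = P j q → 0 < s j * n j q c' →
      ∃ m, (∀ᶠ t in 𝓝[>] (0 : ℝ), step s (c t) = m + 1) ∧ ∀ᶠ t in 𝓝[<] (0 : ℝ), step s (c t) = m

theorem HasDerivAt.euclidean_apply {c : ℝ → EuclideanSpace ℝ (Fin 3)}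
    {c' : EuclideanSpace ℝ (Fin 3)} {t : ℝ} (h : HasDerivAt c c' t) (a : Fin 3) :
    HasDerivAt (fun t => c t a) (c' a) t :=
  ((EuclideanSpace.proj (𝕜 := ℝ) a).hasFDerivAt.comp_hasDerivAt t h :)

/-- Finitely many coordinate planes. -/
noncomputable def planeModel (h : Prop) {k : ℕ} (a : Fin k → Fin 3) (ha : Function.Injective a)
    (L : Fin k → EuclideanSpace ℝ (Fin 2) →L[ℝ] EuclideanSpace ℝ (Fin 3))
    (hinj : ∀ j, Function.Injective (L j)) (hL : ∀ j q, L j q (a j) = 0)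
    (hsurj : ∀ j v, v (a j) = 0 → ∃ q, L j q = v) (hdom : h → ∀ j q, L j q 0 = q 0) :
    SheetModel h k where
  P j q := L j q
  D j _ := L j
  hasFDerivAt j q := (L j).hasFDerivAt
  Q _ := univ
  injective_D j _ _ := hinj j
  n j _ := EuclideanSpace.proj (a j)
  continuous_n j := continuous_const
  n_ne_zero j q _ hn := by
    have := DFunLike.congr_fun hn (EuclideanSpace.single (a j) 1)
    simp at this
  n_D j q u := hL j u
  preconnected j ε _ _ := by
    have : {q | q ∈ paramDomain h ∧ q ∈ univ ∧ L j q ∈ openCube ε} =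
        paramDomain h ∩ L j ⁻¹' openCube ε := by
      ext
      simp
    rw [this]
    exact ((convex_paramDomain h).inter
      ((convex_openCube ε).linear_preimage (L j).toLinearMap)).isPreconnected
  doubleValues_subset := by
    rintro v ⟨-, ⟨j, q⟩, ⟨j', q'⟩, hne, -, -, h1, h2⟩
    dsimp only at h1 h2
    have hjj : j ≠ j' := by
      rintro rfl
      exact hne (by rw [hinj j (h1.trans h2.symm)])
    exact ⟨a j, a j', ha.ne hjj, by rw [← h1, hL], by rw [← h2, hL]⟩
  diag δ hδ j q hq := by
    have h1 := hL j q
    rw [hq] at h1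
    revert h1
    generalize a j = b
    fin_cases b <;> simp [hδ.ne']
  -- The number of planes on whose positive side, with respect to `s`, the point lies.
  step s v := ∑ j, if 0 < (s j : ℝ) * v (a j) then 1 else 0
  step_eventually s v hv hne := by
    have hva : ∀ j, v (a j) ≠ 0 := by
      intro j hj
      obtain ⟨q, hq⟩ := hsurj j v hj
      refine hne j q (fun hh => ?_) hq
      rw [← hdom hh j q, hq]
      exact hv hh
    have : ∀ᶠ w in 𝓝 v, ∀ j, (0 < (s j : ℝ) * w (a j) ↔ 0 < (s j : ℝ) * v (a j)) := by
      rw [eventually_all]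
      intro j
      by_cases hs : s j = 0
      · simp [hs]
      have hne : (s j : ℝ) * v (a j) ≠ 0 := mul_ne_zero (by exact_mod_cast hs) (hva j)
      have hc : Continuous fun w : EuclideanSpace ℝ (Fin 3) => (s j : ℝ) * w (a j) := by fun_prop
      rcases hne.lt_or_gt with hlt | hgt
      · filter_upwards [hc.continuousAt.eventually_lt continuousAt_const hlt] with w hw
        exact iff_of_false hw.not_gt hlt.not_gt
      · filter_upwards [continuousAt_const.eventually_lt hc.continuousAt hgt] with w hw
        exact iff_of_true hw hgt
    filter_upwards [this] with w hw
    simp only [hw]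
  mem_Q _ _ _ _ := mem_univ _
  step_jump s hs j q hq hv hnd c c' hc hc0 hpos := by
    -- A point on a second plane would be a double value, so the curve stays strictly on one side of
    -- every other plane for small times.
    have hother : ∀ j', j' ≠ j → c 0 (a j') ≠ 0 := by
      intro j' hj' h0
      obtain ⟨q', hq'⟩ := hsurj j' _ h0
      refine hnd (subset_closure ⟨hv, ⟨j, q⟩, ⟨j', q'⟩, ?_, hq, ?_, rfl, hq'.trans hc0⟩)
      · intro hEq
        exact hj' (congrArg Prod.fst hEq).symm
      · intro hh
        rw [← hdom hh j' q', hq', hc0]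
        exact hv hh
    have hterm : ∀ j', j' ≠ j → ∀ᶠ t in 𝓝 (0 : ℝ),
        (0 < (s j' : ℝ) * c t (a j') ↔ 0 < (s j' : ℝ) * c 0 (a j')) := by
      intro j' hj'
      have hs0 : (s j' : ℝ) ≠ 0 := by rcases hs j' with h | h <;> simp [h]
      have hne := mul_ne_zero hs0 (hother j' hj')
      have hcc : ContinuousAt (fun t => (s j' : ℝ) * c t (a j')) 0 :=
        continuousAt_const.mul (hc.euclidean_apply (a j')).continuousAt
      rcases hne.lt_or_gt with hlt | hgt
      · filter_upwards [hcc.eventually_lt continuousAt_const hlt] with w hw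
        exact iff_of_false hw.not_gt hlt.not_gt
      · filter_upwards [continuousAt_const.eventually_lt hcc hgt] with w hw
        exact iff_of_true hw hgt
    have hall : ∀ᶠ t in 𝓝 (0 : ℝ), ∀ j', j' ≠ j →
        (0 < (s j' : ℝ) * c t (a j') ↔ 0 < (s j' : ℝ) * c 0 (a j')) := by
      rw [eventually_all]
      intro j'
      by_cases hj' : j' = j
      · exact Eventually.of_forall fun t h => absurd hj' h
      · filter_upwards [hterm j' hj'] with t ht _ using ht
    obtain ⟨h1, h2⟩ := ((hc.euclidean_apply (a j)).const_mul (s j : ℝ)).eventually_pos_neg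
      (by rw [hc0, hL, mul_zero]) hpos
    refine ⟨∑ j' ∈ Finset.univ.erase j, if 0 < (s j' : ℝ) * c 0 (a j') then 1 else 0, ?_, ?_⟩
    · filter_upwards [h1, mem_nhdsWithin_of_mem_nhds hall] with t ht ht'
      rw [← Finset.sum_erase_add _ _ (Finset.mem_univ j), if_pos ht]
      congr 1
      refine Finset.sum_congr rfl fun j' hj' => ?_
      simp only [ht' j' (Finset.ne_of_mem_erase hj')]
    · filter_upwards [h2, mem_nhdsWithin_of_mem_nhds hall] with t ht ht'
      rw [← Finset.sum_erase_add _ _ (Finset.mem_univ j), if_neg ht.not_gt, add_zero]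
      refine Finset.sum_congr rfl fun j' hj' => ?_
      simp only [ht' j' (Finset.ne_of_mem_erase hj')]

theorem euclidean_two_ext {q r : EuclideanSpace ℝ (Fin 2)} (h0 : q 0 = r 0) (h1 : q 1 = r 1) :
    q = r := by
  ext a
  fin_cases a
  exacts [h0, h1]

theorem euclidean_three_ext {v w : EuclideanSpace ℝ (Fin 3)} (h0 : v 0 = w 0) (h1 : v 1 = w 1)
    (h2 : v 2 = w 2) : v = w := by
  ext a
  fin_cases a
  exacts [h0, h1, h2]

/-- The parametrization `planeXY` as a linear map. -/
noncomputable def planeXYL : EuclideanSpace ℝ (Fin 2) →L[ℝ] EuclideanSpace ℝ (Fin 3) :=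
  LinearMap.toContinuousLinearMap
    { toFun := planeXY
      map_add' := fun q r => by apply euclidean_three_ext <;> simp [planeXY]
      map_smul' := fun c q => by apply euclidean_three_ext <;> simp [planeXY] }

/-- The parametrization `planeXZ` as a linear map. -/
noncomputable def planeXZL : EuclideanSpace ℝ (Fin 2) →L[ℝ] EuclideanSpace ℝ (Fin 3) :=
  LinearMap.toContinuousLinearMap
    { toFun := planeXZ
      map_add' := fun q r => by apply euclidean_three_ext <;> simp [planeXZ]
      map_smul' := fun c q => by apply euclidean_three_ext <;> simp [planeXZ] }

/-- The parametrization `planeYZ` as a linear map. -/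
noncomputable def planeYZL : EuclideanSpace ℝ (Fin 2) →L[ℝ] EuclideanSpace ℝ (Fin 3) :=
  LinearMap.toContinuousLinearMap
    { toFun := planeYZ
      map_add' := fun q r => by apply euclidean_three_ext <;> simp [planeYZ]
      map_smul' := fun c q => by apply euclidean_three_ext <;> simp [planeYZ] }

theorem planeXYL_apply (q : EuclideanSpace ℝ (Fin 2)) : planeXYL q = planeXY q := rfl

theorem planeXZL_apply (q : EuclideanSpace ℝ (Fin 2)) : planeXZL q = planeXZ q := rfl

theorem planeYZL_apply (q : EuclideanSpace ℝ (Fin 2)) : planeYZL q = planeYZ q := rfl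

theorem planeXY_injective : Function.Injective planeXY := fun q r h =>
  euclidean_two_ext (by simpa [planeXY] using congrArg (fun v => v 0) h)
    (by simpa [planeXY] using congrArg (fun v => v 1) h)

theorem planeXZ_injective : Function.Injective planeXZ := fun q r h =>
  euclidean_two_ext (by simpa [planeXZ] using congrArg (fun v => v 0) h)
    (by simpa [planeXZ] using congrArg (fun v => v 2) h)

theorem planeYZ_injective : Function.Injective planeYZ := fun q r h =>
  euclidean_two_ext (by simpa [planeYZ] using congrArg (fun v => v 1) h)
    (by simpa [planeYZ] using congrArg (fun v => v 2) h)

theorem exists_planeXY_eq {v : EuclideanSpace ℝ (Fin 3)} (hv : v 2 = 0) : ∃ q, planeXY q = v :=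
  ⟨!₂[v 0, v 1], euclidean_three_ext (by simp [planeXY]) (by simp [planeXY]) (by simp [planeXY, hv])⟩

theorem exists_planeXZ_eq {v : EuclideanSpace ℝ (Fin 3)} (hv : v 1 = 0) : ∃ q, planeXZ q = v :=
  ⟨!₂[v 0, v 2], euclidean_three_ext (by simp [planeXZ]) (by simp [planeXZ, hv]) (by simp [planeXZ])⟩

theorem exists_planeYZ_eq {v : EuclideanSpace ℝ (Fin 3)} (hv : v 0 = 0) : ∃ q, planeYZ q = v :=
  ⟨!₂[v 1, v 2], euclidean_three_ext (by simp [planeYZ, hv]) (by simp [planeYZ]) (by simp [planeYZ])⟩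

/-- One sheet. -/
noncomputable def singleModel (h : Prop) : SheetModel h 1 :=
  planeModel h ![2] (Function.injective_of_subsingleton _) ![planeXYL]
    (fun j => by
      fin_cases j
      exact planeXY_injective)
    (by simp [planeXYL_apply, planeXY])
    (fun j v hv => by
      fin_cases j
      exact exists_planeXY_eq hv)
    (by simp [planeXYL_apply, planeXY])

/-- Two sheets. -/
noncomputable def doubleModel (h : Prop) : SheetModel h 2 :=
  planeModel h ![2, 1] (by decide) ![planeXYL, planeXZL]
    (by simpa [Fin.forall_fin_two] using ⟨planeXY_injective, planeXZ_injective⟩)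
    (by simp [Fin.forall_fin_two, planeXYL_apply, planeXY, planeXZL_apply, planeXZ])
    (by simpa [Fin.forall_fin_two] using
      ⟨fun v hv => exists_planeXY_eq hv, fun v hv => exists_planeXZ_eq hv⟩)
    (by simp [Fin.forall_fin_two, planeXYL_apply, planeXY, planeXZL_apply, planeXZ])

/-- Three sheets. -/
noncomputable def tripleModel : SheetModel False 3 :=
  planeModel False ![2, 1, 0] (by decide) ![planeXYL, planeXZL, planeYZL]
    (fun j => by
      fin_cases j
      exacts [planeXY_injective, planeXZ_injective, planeYZ_injective])
    (fun j q => by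
      fin_cases j <;> simp [planeXYL_apply, planeXY, planeXZL_apply, planeXZ, planeYZL_apply, planeYZ])
    (fun j v hv => by
      fin_cases j
      exacts [exists_planeXY_eq hv, exists_planeXZ_eq hv, exists_planeYZ_eq hv])
    False.elim

theorem whitneyUmbrella_apply_zero (q : EuclideanSpace ℝ (Fin 2)) :
    whitneyUmbrella q 0 = q 0 := by simp [whitneyUmbrella]

theorem whitneyUmbrella_apply_one (q : EuclideanSpace ℝ (Fin 2)) :
    whitneyUmbrella q 1 = q 1 ^ 2 := by simp [whitneyUmbrella]

theorem whitneyUmbrella_apply_two (q : EuclideanSpace ℝ (Fin 2)) :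
    whitneyUmbrella q 2 = q 0 * q 1 := by simp [whitneyUmbrella]

/-- The derivative of Whitney's umbrella. -/
noncomputable def whitneyDeriv (q : EuclideanSpace ℝ (Fin 2)) :
    EuclideanSpace ℝ (Fin 2) →L[ℝ] EuclideanSpace ℝ (Fin 3) :=
  LinearMap.toContinuousLinearMap
    { toFun := fun u => !₂[u 0, 2 * q 1 * u 1, q 0 * u 1 + q 1 * u 0]
      map_add' := fun u w => by apply euclidean_three_ext <;> simp <;> ring
      map_smul' := fun c u => by apply euclidean_three_ext <;> simp <;> ring }

theorem whitneyDeriv_apply (q u : EuclideanSpace ℝ (Fin 2)) :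
    whitneyDeriv q u = !₂[u 0, 2 * q 1 * u 1, q 0 * u 1 + q 1 * u 0] := rfl

theorem hasFDerivAt_whitneyUmbrella (q : EuclideanSpace ℝ (Fin 2)) :
    HasFDerivAt whitneyUmbrella (whitneyDeriv q) q := by
  rw [← hasFDerivWithinAt_univ, hasFDerivWithinAt_euclidean]
  intro a
  rw [hasFDerivWithinAt_univ]
  have h0 : HasFDerivAt (fun q : EuclideanSpace ℝ (Fin 2) => q 0) (EuclideanSpace.proj (𝕜 := ℝ) (0 : Fin 2)) q :=
    (EuclideanSpace.proj (𝕜 := ℝ) (0 : Fin 2)).hasFDerivAt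
  have h1 : HasFDerivAt (fun q : EuclideanSpace ℝ (Fin 2) => q 1) (EuclideanSpace.proj (𝕜 := ℝ) (1 : Fin 2)) q :=
    (EuclideanSpace.proj (𝕜 := ℝ) (1 : Fin 2)).hasFDerivAt
  fin_cases a
  · refine h0.congr_fderiv ?_
    ext u
    simp [whitneyDeriv_apply]
  · refine (h1.pow 2).congr_fderiv ?_
    ext u
    simp [whitneyDeriv_apply]
  · refine (h0.mul h1).congr_fderiv ?_
    ext u
    simp [whitneyDeriv_apply]

/-- The parameters `(0, t)` and `(0, -t)` have the same value, so only `t = 0` needs a limit: the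
branch value belongs to the closure although it has a single preimage. -/
theorem whitneyUmbrella_mem_closure {q : EuclideanSpace ℝ (Fin 2)} (hq : q 0 = 0) :
    whitneyUmbrella q ∈ closure (doubleValues False (k := 1) ![whitneyUmbrella]) := by
  have key : ∀ t : ℝ, t ≠ 0 → whitneyUmbrella !₂[0, t] ∈
      doubleValues False (k := 1) ![whitneyUmbrella] := by
    intro t ht
    refine ⟨False.elim, (0, !₂[0, t]), (0, !₂[0, -t]), fun h => ht ?_, False.elim, False.elim,
      rfl, ?_⟩
    · have h1 := congrArg (fun a : Fin 1 × EuclideanSpace ℝ (Fin 2) => a.2 1) h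
      simp at h1
      linarith
    · apply euclidean_three_ext <;> simp [whitneyUmbrella]
  have hqe : q = !₂[0, q 1] := euclidean_two_ext (by simp [hq]) (by simp)
  have hc : Continuous fun t : ℝ => whitneyUmbrella !₂[0, t] := by
    have h1 : Continuous whitneyUmbrella := continuous_iff_continuousAt.2 fun q =>
      (hasFDerivAt_whitneyUmbrella q).continuousAt
    refine h1.comp ((PiLp.continuous_toLp 2 _).comp (continuous_pi fun a => ?_))
    fin_cases a <;> simp <;> fun_prop
  rw [hqe]
  refine mem_closure_of_tendsto (b := 𝓝[≠] (q 1)) (hc.continuousAt.mono_left nhdsWithin_le_nhds) ?_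
  by_cases h1 : q 1 = 0
  · rw [h1]
    filter_upwards [self_mem_nhdsWithin] with t ht using key t ht
  · filter_upwards [mem_nhdsWithin_of_mem_nhds (isOpen_ne.mem_nhds h1)] with t ht using key t ht

/-- The parameter domain is a rectangle punctured at the origin. It is covered by four convex
half-rectangles, chained together through the points `(η, η)`, `(η, -η)` and `(-η, -η)`. -/
theorem preconnected_whitney {ε : ℝ} (h0 : 0 < ε) (h1 : ε ≤ 1) :
    IsPreconnected {q | q ∈ paramDomain False ∧ q ≠ 0 ∧ whitneyUmbrella q ∈ openCube ε} := by
  let A : Set (EuclideanSpace ℝ (Fin 2)) := {q | |q 0| < ε ∧ |q 1| < √ε}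
  have hA : Convex ℝ A := by
    intro v hv w hw s t hs ht hst
    constructor
    · simpa using (convex_ball (0 : ℝ) ε) (mem_ball_zero_iff.2 hv.1) (mem_ball_zero_iff.2 hw.1)
        hs ht hst
    · simpa using (convex_ball (0 : ℝ) (√ε)) (mem_ball_zero_iff.2 hv.2) (mem_ball_zero_iff.2 hw.2)
        hs ht hst
  have hhalf : ∀ l : EuclideanSpace ℝ (Fin 2) →L[ℝ] ℝ, Convex ℝ {q | 0 < l q} := fun l =>
    convex_halfSpace_gt l.toLinearMap.isLinear 0
  have hpos : ∀ a : Fin 2, Convex ℝ {q : EuclideanSpace ℝ (Fin 2) | 0 < q a} := fun a =>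
    hhalf (EuclideanSpace.proj a)
  have hneg : ∀ a : Fin 2, Convex ℝ {q : EuclideanSpace ℝ (Fin 2) | q a < 0} := fun a => by
    have := hhalf (-EuclideanSpace.proj a)
    simpa using this
  have heq : {q | q ∈ paramDomain False ∧ q ≠ 0 ∧ whitneyUmbrella q ∈ openCube ε} =
      ((A ∩ {q | 0 < q 0}) ∪ (A ∩ {q | 0 < q 1})) ∪ ((A ∩ {q | q 0 < 0}) ∪ (A ∩ {q | q 1 < 0})) := by
    -- Because `ε ≤ 1`, the bound on `q 1` gives `|q 1| < 1`, so the third coordinate imposes no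
    -- further condition.
    have hmem : ∀ q, whitneyUmbrella q ∈ openCube ε ↔ q ∈ A := by
      intro q
      have hsq : q 1 ^ 2 < ε ↔ |q 1| < √ε := by
        rw [← sq_abs, Real.lt_sqrt (abs_nonneg _)]
      simp only [openCube, mem_ofPred_eq, Fin.forall_fin_succ, Fin.isValue, IsEmpty.forall_iff,
        whitneyUmbrella, A]
      simp only [Fin.succ_zero_eq_one, Fin.succ_one_eq_two, Fin.isValue,
        Matrix.cons_val_zero, Matrix.cons_val_one, Matrix.cons_val, abs_mul, abs_pow, sq_abs]
      refine ⟨fun h => ⟨h.1, hsq.1 h.2.1⟩, fun h => ⟨h.1, hsq.2 h.2, ?_, trivial⟩⟩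
      have : |q 1| < 1 := h.2.trans_le (Real.sqrt_le_one.2 h1)
      nlinarith [abs_nonneg (q 0), h.1]
    ext q
    simp only [hmem, mem_union, mem_inter_iff, mem_ofPred_eq, paramDomain, false_imp_iff, true_and]
    constructor
    · rintro ⟨hq, hqA⟩
      by_cases hq0 : q 0 = 0
      · have hq1 : q 1 ≠ 0 := fun hq1 => hq (euclidean_two_ext (by simpa) (by simpa))
        rcases hq1.lt_or_gt with h | h <;> simp [hqA, h]
      · rcases Ne.lt_or_gt hq0 with h | h <;> simp [hqA, h]
    · rintro ((⟨hqA, h⟩ | ⟨hqA, h⟩) | (⟨hqA, h⟩ | ⟨hqA, h⟩)) <;> refine ⟨?_, hqA⟩ <;>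
        rintro rfl <;> simp at h
  have hsq : 0 < √ε := Real.sqrt_pos.2 h0
  set η := min ε (√ε) / 2
  have hη : 0 < η := by positivity
  have hη1 : η < ε := by linarith [min_le_left ε (√ε), show 2 * η = min ε (√ε) by simp [η]; ring]
  have hη2 : η < √ε := by linarith [min_le_right ε (√ε), show 2 * η = min ε (√ε) by simp [η]; ring]
  rw [heq]
  have c : ∀ {B : Set (EuclideanSpace ℝ (Fin 2))}, Convex ℝ B → IsPreconnected (A ∩ B) :=
    fun hB => (hA.inter hB).isPreconnected
  refine IsPreconnected.union !₂[η, -η] (Or.inl ?_) (Or.inr ?_)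
    (IsPreconnected.union !₂[η, η] ?_ ?_ (c (hpos 0)) (c (hpos 1)))
    (IsPreconnected.union !₂[-η, -η] ?_ ?_ (c (hneg 0)) (c (hneg 1))) <;>
  simp [A, abs_of_pos hη, hη1, hη2, hη]

/-- Whitney's umbrella. -/
noncomputable def whitneyModel : SheetModel False 1 where
  P := ![whitneyUmbrella]
  D _ := whitneyDeriv
  hasFDerivAt j q := by
    fin_cases j
    exact hasFDerivAt_whitneyUmbrella q
  Q _ := {q | q ≠ 0}
  injective_D j q hq := by
    rw [injective_iff_map_eq_zero]
    intro u hu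
    rw [whitneyDeriv_apply] at hu
    have e0 : u 0 = 0 := by simpa using congrArg (fun v => v 0) hu
    have e1 : 2 * q 1 * u 1 = 0 := by simpa [-mul_eq_zero] using congrArg (fun v => v 1) hu
    have e2 : q 0 * u 1 + q 1 * u 0 = 0 := by simpa using congrArg (fun v => v 2) hu
    refine euclidean_two_ext e0 ?_
    by_contra hu
    have hu1 : u 1 ≠ 0 := hu
    refine hq (euclidean_two_ext ?_ ?_)
    · simpa [e0, hu1] using e2
    · simpa [hu1] using e1
  -- At the value of `q`, the gradient of `z² - x² y` is `q 0` times this covector. Dividing by `q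
  -- 0` leaves a normal that vanishes only at the branch point.
  n _ q := (-2 * q 1 ^ 2) • EuclideanSpace.proj 0 - q 0 • EuclideanSpace.proj 1 +
    (2 * q 1) • EuclideanSpace.proj 2
  continuous_n j := by fun_prop
  n_ne_zero j q hq hn := by
    refine hq (euclidean_two_ext ?_ ?_)
    · have := DFunLike.congr_fun hn (EuclideanSpace.single 1 1)
      simpa using this
    · have := DFunLike.congr_fun hn (EuclideanSpace.single 2 1)
      simpa using this
  n_D j q u := by
    simp [whitneyDeriv_apply]
    ring
  preconnected j ε h0 h1 := by
    fin_cases j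
    exact preconnected_whitney h0 h1
  doubleValues_subset := by
    rintro v ⟨-, ⟨j, q⟩, ⟨j', q'⟩, hne, -, -, h1, h2⟩
    fin_cases j
    fin_cases j'
    dsimp at h1 h2
    have e0 : q 0 = q' 0 := by
      rw [← whitneyUmbrella_apply_zero, ← whitneyUmbrella_apply_zero, h1, h2]
    have e2 : q 0 * q 1 = q' 0 * q' 1 := by
      rw [← whitneyUmbrella_apply_two, ← whitneyUmbrella_apply_two, h1, h2]
    have hq0 : q 0 = 0 := by
      by_contra hq0
      rw [← e0] at e2
      exact hne (by rw [euclidean_two_ext e0 (mul_left_cancel₀ hq0 e2)])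
    refine ⟨0, 2, by decide, ?_, ?_⟩
    · rw [← h1, whitneyUmbrella_apply_zero, hq0]
    · rw [← h1, whitneyUmbrella_apply_two, hq0, zero_mul]
  diag δ hδ j q hq := by
    fin_cases j
    have h1 : q 1 ^ 2 = -δ := by
      rw [← whitneyUmbrella_apply_one]
      exact congrArg (fun v : EuclideanSpace ℝ (Fin 3) => v 1) hq
    nlinarith [sq_nonneg (q 1)]
  -- The lobes of `z² < x² y` are separated by the sign of `x`. The normal points out of the lobe `x
  -- > 0` and into the lobe `x < 0`, hence the opposite values.
  step s v := if v 2 ^ 2 < v 0 ^ 2 * v 1 then (if 0 < v 0 then -s 0 else s 0) else 0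
  step_eventually s v _ hne := by
    have hc2 : Continuous fun w : EuclideanSpace ℝ (Fin 3) => w 2 ^ 2 := by fun_prop
    have hc01 : Continuous fun w : EuclideanSpace ℝ (Fin 3) => w 0 ^ 2 * w 1 := by fun_prop
    have hc0 : Continuous fun w : EuclideanSpace ℝ (Fin 3) => w 0 := by fun_prop
    have hc1 : Continuous fun w : EuclideanSpace ℝ (Fin 3) => w 1 := by fun_prop
    rcases lt_trichotomy (v 2 ^ 2) (v 0 ^ 2 * v 1) with hlt | heq | hgt
    · have hv0 : v 0 ≠ 0 := by
        intro h0
        rw [h0] at hlt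
        nlinarith [sq_nonneg (v 2)]
      rcases hv0.lt_or_gt with h0 | h0
      · filter_upwards [hc2.continuousAt.eventually_lt hc01.continuousAt hlt,
          hc0.continuousAt.eventually_lt continuousAt_const h0] with w hw hw0
        rw [if_pos hw, if_pos hlt, if_neg hw0.not_gt, if_neg h0.not_gt]
      · filter_upwards [hc2.continuousAt.eventually_lt hc01.continuousAt hlt,
          continuousAt_const.eventually_lt hc0.continuousAt h0] with w hw hw0
        rw [if_pos hw, if_pos hlt, if_pos hw0, if_pos h0]
    -- Equality off the umbrella occurs only on the negative `y`-axis, the part of the zero set of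
    -- `z² - x² y` that the parametrization misses; both regions near it have value 0.
    · have hv1 : v 1 < 0 := by
        by_contra hv1
        rw [not_lt] at hv1
        by_cases h0 : v 0 = 0
        · have h2 : v 2 = 0 := by simpa [h0] using heq
          refine hne 0 !₂[0, √(v 1)] False.elim (euclidean_three_ext ?_ ?_ ?_) <;>
            simp [whitneyUmbrella, h0, h2, Real.sq_sqrt hv1]
        · refine hne 0 !₂[v 0, v 2 / v 0] False.elim (euclidean_three_ext ?_ ?_ ?_)
          · simp [whitneyUmbrella]
          · simp [whitneyUmbrella, div_pow, heq, h0]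
          · simp [whitneyUmbrella, mul_div_cancel₀, h0]
      filter_upwards [hc1.continuousAt.eventually_lt continuousAt_const hv1] with w hw
      rw [if_neg, if_neg heq.not_lt]
      nlinarith [sq_nonneg (w 2), mul_nonneg (sq_nonneg (w 0)) (neg_nonneg.2 hw.le)]
    · filter_upwards [hc01.continuousAt.eventually_lt hc2.continuousAt hgt] with w hw
      rw [if_neg hw.not_gt, if_neg hgt.not_gt]
  mem_Q j q _ hq := by
    fin_cases j
    rintro rfl
    exact hq (whitneyUmbrella_mem_closure rfl)
  step_jump s hs j q _ _ hnd c c' hc hc0 hpos := by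
    fin_cases j
    have hq0 : q 0 ≠ 0 := fun h => hnd (whitneyUmbrella_mem_closure h)
    have e0 : c 0 0 = q 0 := by rw [hc0]; exact whitneyUmbrella_apply_zero q
    have e1 : c 0 1 = q 1 ^ 2 := by rw [hc0]; exact whitneyUmbrella_apply_one q
    have e2 : c 0 2 = q 0 * q 1 := by rw [hc0]; exact whitneyUmbrella_apply_two q
    have hpos' : 0 < (s 0 : ℝ) * (-2 * q 1 ^ 2 * c' 0 - q 0 * c' 1 + 2 * q 1 * c' 2) := by
      simpa using hpos
    -- The factor `q 0` relates the gradient to `n`, so the derivative is `q 0 ^ 2` times the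
    -- positive normal speed.
    have hG : HasDerivAt (fun t => q 0 * s 0 * (c t 2 ^ 2 - c t 0 ^ 2 * c t 1))
        (q 0 ^ 2 * (s 0 * (-2 * q 1 ^ 2 * c' 0 - q 0 * c' 1 + 2 * q 1 * c' 2))) 0 := by
      have := (((hc.euclidean_apply 2).pow 2).sub (((hc.euclidean_apply 0).pow 2).mul
        (hc.euclidean_apply 1))).const_mul (q 0 * s 0)
      refine this.congr_deriv ?_
      simp only [Pi.pow_apply, e0, e1, e2]
      push_cast
      ring
    obtain ⟨h1, h2⟩ := hG.eventually_pos_neg (by simp only [e0, e1, e2]; ring) (by positivity)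
    have hcont : ContinuousAt (fun t => c t 0) 0 := (hc.euclidean_apply 0).continuousAt
    rcases hq0.lt_or_gt with hneg | hpos0
    · have hev : ∀ᶠ t in 𝓝 (0 : ℝ), c t 0 < 0 :=
        hcont.eventually_lt continuousAt_const (by rwa [e0])
      rcases hs 0 with hs0 | hs0 <;> rw [hs0] at h1 h2 ⊢
      · refine ⟨0, ?_, ?_⟩
        · filter_upwards [h1, mem_nhdsWithin_of_mem_nhds hev] with t ht ht0
          rw [if_pos, if_neg ht0.not_gt]
          · rfl
          · push_cast at ht; nlinarith
        · filter_upwards [h2, mem_nhdsWithin_of_mem_nhds hev] with t ht ht0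
          rw [if_neg]
          push_cast at ht; nlinarith
      · refine ⟨-1, ?_, ?_⟩
        · filter_upwards [h1, mem_nhdsWithin_of_mem_nhds hev] with t ht ht0
          rw [if_neg]
          · rfl
          push_cast at ht; nlinarith
        · filter_upwards [h2, mem_nhdsWithin_of_mem_nhds hev] with t ht ht0
          rw [if_pos, if_neg ht0.not_gt]
          push_cast at ht; nlinarith
    · have hev : ∀ᶠ t in 𝓝 (0 : ℝ), 0 < c t 0 :=
        continuousAt_const.eventually_lt hcont (by rwa [e0])
      rcases hs 0 with hs0 | hs0 <;> rw [hs0] at h1 h2 ⊢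
      · refine ⟨-1, ?_, ?_⟩
        · filter_upwards [h1, mem_nhdsWithin_of_mem_nhds hev] with t ht ht0
          rw [if_neg]
          · rfl
          push_cast at ht; nlinarith
        · filter_upwards [h2, mem_nhdsWithin_of_mem_nhds hev] with t ht ht0
          rw [if_pos, if_pos ht0]
          push_cast at ht; nlinarith
      · refine ⟨0, ?_, ?_⟩
        · filter_upwards [h1, mem_nhdsWithin_of_mem_nhds hev] with t ht ht0
          rw [if_pos, if_pos ht0]
          · rfl
          push_cast at ht; nlinarith
        · filter_upwards [h2, mem_nhdsWithin_of_mem_nhds hev] with t ht ht0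
          rw [if_neg]
          push_cast at ht; nlinarith

/-! ### Coordinates in which the surface is a model -/

/-- Coordinates around the point `p` in which the map `i` looks like a given model. -/
structure LocalPicture {M : Type u} [TopologicalSpace M] [ChartedSpace (EuclideanHalfSpace 3) M]
    {F : Type v} [TopologicalSpace F] [ChartedSpace (EuclideanHalfSpace 2) F]
    {h : Prop} {k : ℕ} (m : SheetModel h k) (i : F → M) (p : M) where
  /-- The domain of the coordinates. -/
  S : Set M
  /-- The coordinates. -/
  Φ : M → EuclideanSpace ℝ (Fin 3)
  /-- Their image is the intersection of this open set with the model domain. -/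
  T : Set (EuclideanSpace ℝ (Fin 3))
  /-- The inverse of the coordinates. -/
  σ : EuclideanSpace ℝ (Fin 3) → M
  isOpen_S : IsOpen S
  isOpen_T : IsOpen T
  mem_S : p ∈ S
  Φ_center : Φ p = 0
  Φ_mem : ∀ y ∈ S, Φ y ∈ T ∩ modelDomain h
  σ_mem : ∀ v ∈ T ∩ modelDomain h, σ v ∈ S
  Φ_σ : ∀ v ∈ T ∩ modelDomain h, Φ (σ v) = v
  σ_Φ : ∀ y ∈ S, σ (Φ y) = y
  contMDiffOn_Φ : ContMDiffOn (𝓡∂ 3) 𝓘(ℝ, EuclideanSpace ℝ (Fin 3)) ∞ Φ S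
  contMDiffOn_σ : ContMDiffOn 𝓘(ℝ, EuclideanSpace ℝ (Fin 3)) (𝓡∂ 3) ∞ σ (T ∩ modelDomain h)
  surjective_Φ : ∀ y ∈ S,
    Function.Surjective (mfderiv (𝓡∂ 3) 𝓘(ℝ, EuclideanSpace ℝ (Fin 3)) Φ y)
  /-- The domains of the sheets. -/
  Sh : Fin k → Set F
  /-- The coordinates on the sheets. -/
  Ψ : Fin k → F → EuclideanSpace ℝ (Fin 2)
  /-- The inverses of the coordinates on the sheets. -/
  τ : Fin k → EuclideanSpace ℝ (Fin 2) → F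
  isOpen_Sh : ∀ j, IsOpen (Sh j)
  disjoint_Sh : ∀ j j', j ≠ j' → Disjoint (Sh j) (Sh j')
  preimage_S : i ⁻¹' S = ⋃ j, Sh j
  mdifferentiableAt_Ψ : ∀ j, ∀ x ∈ Sh j,
    MDifferentiableAt (𝓡∂ 2) 𝓘(ℝ, EuclideanSpace ℝ (Fin 2)) (Ψ j) x
  injective_Ψ : ∀ j, ∀ x ∈ Sh j,
    Function.Injective (mfderiv (𝓡∂ 2) 𝓘(ℝ, EuclideanSpace ℝ (Fin 2)) (Ψ j) x)
  Ψ_mem : ∀ j, ∀ x ∈ Sh j, Ψ j x ∈ paramDomain h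
  τ_mem : ∀ j, ∀ q ∈ paramDomain h, m.P j q ∈ T → τ j q ∈ Sh j
  Ψ_τ : ∀ j, ∀ q ∈ paramDomain h, m.P j q ∈ T → Ψ j (τ j q) = q
  τ_Ψ : ∀ j, ∀ x ∈ Sh j, τ j (Ψ j x) = x
  continuousOn_τ : ∀ j, ContinuousOn (τ j) {q | q ∈ paramDomain h ∧ m.P j q ∈ T}
  Φ_i : ∀ j, ∀ x ∈ Sh j, Φ (i x) = m.P j (Ψ j x)

section

variable {𝕜 : Type*} [NontriviallyNormedField 𝕜]
  {E : Type*} [NormedAddCommGroup E] [NormedSpace 𝕜 E] {H : Type*} [TopologicalSpace H]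
  {I : ModelWithCorners 𝕜 E H} {N : Type*} [TopologicalSpace N] [ChartedSpace H N]
  {E' : Type*} [NormedAddCommGroup E'] [NormedSpace 𝕜 E'] {H' : Type*} [TopologicalSpace H']
  {K : ModelWithCorners 𝕜 E' H'} {n : WithTop ℕ∞}

theorem PartialDiffeomorph.mdifferentiableAt_model_comp (φ : PartialDiffeomorph I K N H' n)
    (hn : n ≠ 0) {x : N} (hx : x ∈ φ.source) :
    MDifferentiableAt I 𝓘(𝕜, E') (fun y => K (φ y)) x :=
  K.mdifferentiableAt.comp x (φ.mdifferentiableAt hn hx)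

theorem PartialDiffeomorph.bijective_mfderiv_model_comp (φ : PartialDiffeomorph I K N H' n)
    (hn : n ≠ 0) {x : N} (hx : x ∈ φ.source) :
    Function.Bijective (mfderiv I 𝓘(𝕜, E') (fun y => K (φ y)) x) := by
  have h1 : HasMFDerivAt I 𝓘(𝕜, E') (fun y => K (φ y)) x
      ((ContinuousLinearMap.id 𝕜 E').comp (mfderiv I K φ x)) :=
    K.hasMFDerivAt.comp x (φ.mdifferentiableAt hn hx).hasMFDerivAt
  rw [h1.mfderiv]
  exact ((φ.isLocalDiffeomorphAt I K n hx).mfderivToContinuousLinearEquiv hn).bijective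

theorem PartialDiffeomorph.contMDiffOn_model_comp (φ : PartialDiffeomorph I K N H' n) :
    ContMDiffOn I 𝓘(𝕜, E') n (fun y => K (φ y)) φ.source :=
  K.contMDiff.comp_contMDiffOn φ.contMDiffOn

end

section LocalPictures

variable {M : Type u} [TopologicalSpace M] [ChartedSpace (EuclideanHalfSpace 3) M]
  {F : Type v} [TopologicalSpace F] [ChartedSpace (EuclideanHalfSpace 2) F]

theorem LooksLikeAt.nonempty_localPicture {HS HN : Type} [TopologicalSpace HS]
    [TopologicalSpace HN] {J : ModelWithCorners ℝ (EuclideanSpace ℝ (Fin 2)) HS}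
    {K : ModelWithCorners ℝ (EuclideanSpace ℝ (Fin 3)) HN} {k : ℕ} {g : Fin k → HS → HN}
    {i : F → M} {p : M} (hi : LooksLikeAt J K g i p) {h : Prop} (m : SheetModel h k)
    (hJ : range J = paramDomain h) (hK : range K = modelDomain h)
    (hg : ∀ j q, K (g j q) = m.P j (J q)) : Nonempty (LocalPicture m i p) := by
  obtain ⟨φ, hp, hφp, ψ, hdisj, hpre, hψ⟩ := hi
  obtain ⟨T, hT, hTφ⟩ := K.isClosedEmbedding.isInducing.isOpen_iff.1 φ.open_target
  have hmemT : ∀ y, K y ∈ T ↔ y ∈ φ.target := fun y => by rw [← hTφ]; rfl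
  have hK' : ∀ v ∈ modelDomain h, K (K.symm v) = v := fun v hv => K.right_inv (hK ▸ hv)
  have hJ' : ∀ q ∈ paramDomain h, J (J.symm q) = q := fun q hq => J.right_inv (hJ ▸ hq)
  have hKT : ∀ v ∈ T ∩ modelDomain h, K.symm v ∈ φ.target := fun v hv => by
    rw [← hmemT, hK' v hv.2]
    exact hv.1
  have hJT : ∀ j, ∀ q ∈ paramDomain h, m.P j q ∈ T → J.symm q ∈ (ψ j).target := by
    intro j q hq hqT
    rw [(hψ j).1, mem_preimage, ← hmemT, hg, hJ' q hq]
    exact hqT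
  exact ⟨
    { S := φ.source
      Φ := fun y => K (φ y)
      T := T
      σ := fun v => φ.symm (K.symm v)
      isOpen_S := φ.open_source
      isOpen_T := hT
      mem_S := hp
      Φ_center := hφp
      Φ_mem := fun y hy => ⟨(hmemT _).2 (φ.map_source hy), hK ▸ mem_range_self _⟩
      σ_mem := fun v hv => φ.map_target (hKT v hv)
      Φ_σ := fun v hv => (congrArg K (φ.right_inv (hKT v hv))).trans (hK' v hv.2)
      σ_Φ := fun y hy => (congrArg φ.symm (K.left_inv _)).trans (φ.left_inv hy)
      contMDiffOn_Φ := φ.contMDiffOn_model_comp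
      contMDiffOn_σ := φ.contMDiffOn_invFun.comp
        (K.contMDiffOn_symm.mono fun v hv => hK ▸ hv.2) fun v hv => hKT v hv
      surjective_Φ := fun y hy => (φ.bijective_mfderiv_model_comp (by simp) hy).2
      Sh := fun j => (ψ j).source
      Ψ := fun j x => J (ψ j x)
      τ := fun j q => (ψ j).symm (J.symm q)
      isOpen_Sh := fun j => (ψ j).open_source
      disjoint_Sh := hdisj
      preimage_S := hpre
      mdifferentiableAt_Ψ := fun j x hx => (ψ j).mdifferentiableAt_model_comp (by simp) hx
      injective_Ψ := fun j x hx => ((ψ j).bijective_mfderiv_model_comp (by simp) hx).1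
      Ψ_mem := fun j x _ => hJ ▸ mem_range_self _
      τ_mem := fun j q hq hqT => (ψ j).map_target (hJT j q hq hqT)
      Ψ_τ := fun j q hq hqT =>
        (congrArg J ((ψ j).right_inv (hJT j q hq hqT))).trans (hJ' q hq)
      τ_Ψ := fun j x hx => (congrArg (ψ j).symm (J.left_inv _)).trans ((ψ j).left_inv hx)
      continuousOn_τ := fun j => (ψ j).contMDiffOn_invFun.continuousOn.comp
        J.continuous_symm.continuousOn fun q hq => hJT j q hq.1 hq.2
      Φ_i := fun j x hx => (congrArg K ((hψ j).2 x hx)).trans (hg j _) }⟩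

theorem range_halfPlane (h : Prop) (hh : h) : range (𝓡∂ 2) = paramDomain h := by
  rw [range_modelWithCornersEuclideanHalfSpace]
  ext
  simp [paramDomain, hh]

theorem range_halfSpace (h : Prop) (hh : h) : range (𝓡∂ 3) = modelDomain h := by
  rw [range_modelWithCornersEuclideanHalfSpace]
  ext
  simp [modelDomain, hh]

theorem range_plane : range (𝓡 2) = paramDomain False := by
  ext
  simp [paramDomain]

theorem range_space : range (𝓡 3) = modelDomain False := by
  ext
  simp [modelDomain]

namespace LocalPicture

variable {h : Prop} {k : ℕ} {m : SheetModel h k} {i : F → M} {p : M} (c : LocalPicture m i p)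

theorem map_mem_S {j : Fin k} {x : F} (hx : x ∈ c.Sh j) : i x ∈ c.S := by
  have : x ∈ i ⁻¹' c.S := by
    rw [c.preimage_S]
    exact mem_iUnion_of_mem j hx
  exact this

theorem exists_mem_Sh {x : F} (hx : i x ∈ c.S) : ∃ j, x ∈ c.Sh j := by
  have : x ∈ i ⁻¹' c.S := hx
  rwa [c.preimage_S, mem_iUnion] at this

theorem map_τ {j : Fin k} {q : EuclideanSpace ℝ (Fin 2)} (hq : q ∈ paramDomain h)
    (hqT : m.P j q ∈ c.T) : i (c.τ j q) = c.σ (m.P j q) := by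
  have hτ := c.τ_mem j q hq hqT
  rw [← c.σ_Φ _ (c.map_mem_S hτ), c.Φ_i j _ hτ, c.Ψ_τ j q hq hqT]

theorem mem_range_of_eq {y : M} (hy : y ∈ c.S) {j : Fin k} {q : EuclideanSpace ℝ (Fin 2)}
    (hq : q ∈ paramDomain h) (hqy : m.P j q = c.Φ y) : y ∈ range i :=
  ⟨c.τ j q, by rw [c.map_τ hq (hqy ▸ (c.Φ_mem y hy).1), hqy, c.σ_Φ y hy]⟩

/-- Distinct model parameters over one value in `T` give distinct points of `F` over one point of
`M`; continuity of `σ` carries this to the closure. -/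
theorem mem_intersectionGraph {y : M} (hy : y ∈ c.S)
    (hyD : c.Φ y ∈ closure (doubleValues h m.P)) : y ∈ intersectionGraph i := by
  have hT := c.Φ_mem y hy
  have h1 : c.Φ y ∈ closure (doubleValues h m.P ∩ c.T) := by
    rw [inter_comm]
    exact c.isOpen_T.inter_closure ⟨hT.1, hyD⟩
  have h2 : ContinuousWithinAt c.σ (doubleValues h m.P ∩ c.T) (c.Φ y) :=
    (c.contMDiffOn_σ.continuousOn _ hT).mono fun v hv => ⟨hv.2, hv.1.1⟩
  have h3 := h2.mem_closure_image h1
  rw [c.σ_Φ y hy] at h3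
  refine closure_mono ?_ h3
  rintro _ ⟨v, ⟨⟨hv, a, b, hab, ha, hb, hav, hbv⟩, hvT⟩, rfl⟩
  have haT : m.P a.1 a.2 ∈ c.T := hav ▸ hvT
  have hbT : m.P b.1 b.2 ∈ c.T := hbv ▸ hvT
  refine ⟨c.τ a.1 a.2, ?_, c.τ b.1 b.2, ?_, fun heq => ?_⟩
  · rw [mem_preimage, mem_singleton_iff, c.map_τ ha haT, hav]
  · rw [mem_preimage, mem_singleton_iff, c.map_τ hb hbT, hbv]
  · have h4 := c.τ_mem a.1 a.2 ha haT
    have h5 := c.τ_mem b.1 b.2 hb hbT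
    have hj : a.1 = b.1 := by
      by_contra hj
      exact (c.disjoint_Sh _ _ hj).le_bot ⟨h4, heq ▸ h5⟩
    refine hab (Prod.ext hj ?_)
    rw [← c.Ψ_τ a.1 a.2 ha haT, heq, hj, c.Ψ_τ b.1 b.2 hb hbT]

/-- The axes are closed and contain all model double values, so a whole neighbourhood of `y` is free
of values with several preimages. -/
theorem notMem_intersectionGraph {y : M} (hy : y ∈ c.S) (hyA : c.Φ y ∉ coordAxes) :
    y ∉ intersectionGraph i := by
  rw [intersectionGraph, mem_closure_iff_frequently, not_frequently]
  have h1 : ∀ᶠ y' in 𝓝 y, c.Φ y' ∉ coordAxes :=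
    (c.contMDiffOn_Φ.continuousOn.continuousAt (c.isOpen_S.mem_nhds hy)).eventually_mem
      (isClosed_coordAxes.isOpen_compl.mem_nhds hyA)
  filter_upwards [h1, c.isOpen_S.mem_nhds hy] with y' hy' hyS
  rintro ⟨x₁, hx₁, x₂, hx₂, hne⟩
  rw [mem_preimage, mem_singleton_iff] at hx₁ hx₂
  obtain ⟨j₁, hj₁⟩ := c.exists_mem_Sh (hx₁ ▸ hyS)
  obtain ⟨j₂, hj₂⟩ := c.exists_mem_Sh (hx₂ ▸ hyS)
  refine hy' (m.doubleValues_subset ⟨(c.Φ_mem y' hyS).2, (j₁, c.Ψ j₁ x₁), (j₂, c.Ψ j₂ x₂), ?_,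
    c.Ψ_mem _ _ hj₁, c.Ψ_mem _ _ hj₂, ?_, ?_⟩)
  · intro heq
    obtain rfl : j₁ = j₂ := congrArg Prod.fst heq
    have h2 : c.Ψ j₁ x₁ = c.Ψ j₁ x₂ := congrArg Prod.snd heq
    exact hne (by rw [← c.τ_Ψ _ _ hj₁, h2, c.τ_Ψ _ _ hj₂])
  · rw [← hx₁, c.Φ_i _ _ hj₁]
  · rw [← hx₂, c.Φ_i _ _ hj₂]

theorem continuousAt_Φ {y : M} (hy : y ∈ c.S) : ContinuousAt c.Φ y :=
  c.contMDiffOn_Φ.continuousOn.continuousAt (c.isOpen_S.mem_nhds hy)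

theorem mdifferentiableAt_Φ {y : M} (hy : y ∈ c.S) :
    MDifferentiableAt (𝓡∂ 3) 𝓘(ℝ, EuclideanSpace ℝ (Fin 3)) c.Φ y :=
  (c.contMDiffOn_Φ.mdifferentiableOn (by simp) y hy).mdifferentiableAt (c.isOpen_S.mem_nhds hy)

theorem continuousWithinAt_σ {v : EuclideanSpace ℝ (Fin 3)} (hv : v ∈ c.T ∩ modelDomain h) :
    ContinuousWithinAt c.σ (c.T ∩ modelDomain h) v :=
  c.contMDiffOn_σ.continuousOn v hv

theorem σ_zero : c.σ 0 = p := by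
  rw [← c.Φ_center, c.σ_Φ p c.mem_S]

theorem zero_mem : (0 : EuclideanSpace ℝ (Fin 3)) ∈ c.T ∩ modelDomain h :=
  c.Φ_center ▸ c.Φ_mem p c.mem_S

/-- A small cube whose part in the model domain corresponds to a subset of `U`. -/
theorem exists_cube {U : Set M} (hU : U ∈ 𝓝 p) : ∃ ε, 0 < ε ∧ ε ≤ 1 ∧ openCube ε ⊆ c.T ∧
    ∀ v ∈ openCube ε ∩ modelDomain h, c.σ v ∈ U := by
  have h1 : c.σ ⁻¹' U ∈ 𝓝[c.T ∩ modelDomain h] 0 :=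
    c.continuousWithinAt_σ c.zero_mem (c.σ_zero.symm ▸ hU)
  obtain ⟨W, hW, hWU⟩ := mem_nhdsWithin_iff_exists_mem_nhds_inter.1 h1
  obtain ⟨ε, h0, h1, hε⟩ := exists_openCube_subset
    (inter_mem hW (c.isOpen_T.mem_nhds c.zero_mem.1))
  exact ⟨ε, h0, h1, fun v hv => (hε hv).2, fun v hv => hWU ⟨(hε hv.1).1, (hε hv.1).2, hv.2⟩⟩

theorem mem_closure_compl_range (c : LocalPicture m i p) : p ∈ closure (range i)ᶜ := by
  rw [mem_closure_iff_nhds]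
  intro U hU
  obtain ⟨ε, h0, -, hεT, hεU⟩ := c.exists_cube (inter_mem hU (c.isOpen_S.mem_nhds c.mem_S))
  set v : EuclideanSpace ℝ (Fin 3) := !₂[ε / 2, -(ε / 2), ε / 2]
  have hv : v ∈ openCube ε ∩ modelDomain h := by
    refine ⟨fun a => ?_, fun _ => ?_⟩
    · have : |ε / 2| < ε := by rw [abs_of_pos (by positivity)]; linarith
      fin_cases a <;> simp [v, this]
    · have : 0 ≤ ε / 2 := by positivity
      simp [v, this]
  refine ⟨c.σ v, (hεU v hv).1, ?_⟩
  rintro ⟨x, hx⟩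
  obtain ⟨j, hj⟩ := c.exists_mem_Sh (hx ▸ (hεU v hv).2)
  refine m.diag (ε / 2) (by positivity) j (c.Ψ j x) ?_
  rw [← c.Φ_i j x hj, hx, c.Φ_σ v ⟨hεT hv.1, hv.2⟩]

end LocalPicture

/-- Each value of a generic surface has a local picture, and a picture with a single plane
unless it lies in the intersection graph. -/
theorem IsGenericSurface.exists_localPicture {i : F → M} (hi : IsGenericSurface i) {p : M}
    (hp : p ∈ range i) :
    (∃ (h : Prop) (k : ℕ) (m : SheetModel h k), Nonempty (LocalPicture m i p)) ∧
      (p ∉ intersectionGraph i → ∃ h, Nonempty (LocalPicture (singleModel h) i p)) := by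
  have hgraph : ∀ {h : Prop} {k : ℕ} {m : SheetModel h k}, Nonempty (LocalPicture m i p) →
      0 ∈ closure (doubleValues h m.P) → p ∈ intersectionGraph i := fun ⟨c⟩ h0 =>
    c.mem_intersectionGraph c.mem_S (c.Φ_center.symm ▸ h0)
  have hzero : ∀ {h : Prop} {k : ℕ} {m : SheetModel h k} (j j' : Fin k), j ≠ j' → m.P j 0 = 0 →
      m.P j' 0 = 0 → 0 ∈ closure (doubleValues h m.P) := fun j j' hj h0 h0' =>
    subset_closure ⟨fun _ => le_rfl, (j, 0), (j', 0), fun heq => hj (congrArg Prod.fst heq),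
      fun _ => le_rfl, fun _ => le_rfl, h0, h0'⟩
  -- For every picture other than a single plane, the centre lies in the closure of the double
  -- values, which makes the second assertion vacuous.
  have key : ∀ {h : Prop} {k : ℕ} {m : SheetModel h k}, Nonempty (LocalPicture m i p) →
      0 ∈ closure (doubleValues h m.P) →
      (∃ (h : Prop) (k : ℕ) (m : SheetModel h k), Nonempty (LocalPicture m i p)) ∧
      (p ∉ intersectionGraph i → ∃ h, Nonempty (LocalPicture (singleModel h) i p)) :=
    fun hm h0 => ⟨⟨_, _, _, hm⟩, fun hp => absurd (hgraph hm h0) hp⟩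
  rcases hi.values p hp with hl | hl | hl | hl | hl | hl
  · have hm := LooksLikeAt.nonempty_localPicture hl (singleModel False) range_plane range_space
      fun j q => by fin_cases j; rfl
    exact ⟨⟨_, _, _, hm⟩, fun _ => ⟨_, hm⟩⟩
  · have hm := LooksLikeAt.nonempty_localPicture hl (doubleModel False) range_plane range_space
      fun j q => by fin_cases j <;> rfl
    exact key hm (hzero 0 1 (by decide) (map_zero planeXYL) (map_zero planeXZL))
  · have hm := LooksLikeAt.nonempty_localPicture hl tripleModel range_plane range_space
      fun j q => by fin_cases j <;> rfl
    exact key hm (hzero 0 1 (by decide) (map_zero planeXYL) (map_zero planeXZL))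
  · have hm := LooksLikeAt.nonempty_localPicture hl whitneyModel range_plane range_space
      fun j q => by fin_cases j; rfl
    refine key hm ?_
    have h1 := whitneyUmbrella_mem_closure (q := 0) rfl
    have h2 : whitneyUmbrella 0 = 0 := by
      apply euclidean_three_ext <;> simp [whitneyUmbrella]
    rwa [h2] at h1
  · have hm := LooksLikeAt.nonempty_localPicture hl (singleModel True)
      (range_halfPlane _ trivial) (range_halfSpace _ trivial) fun j q => by fin_cases j; rfl
    exact ⟨⟨_, _, _, hm⟩, fun _ => ⟨_, hm⟩⟩
  · have hm := LooksLikeAt.nonempty_localPicture hl (doubleModel True)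
      (range_halfPlane _ trivial) (range_halfSpace _ trivial) fun j q => by fin_cases j <;> rfl
    exact key hm (hzero 0 1 (by decide) (map_zero planeXYL) (map_zero planeXZL))

/-! ### Signs of the co-orientation and existence of local winding numbers -/

/-- The range of `A` lies in the kernel of `l`, and both have dimension two, so they coincide. -/
theorem ContinuousLinearMap.apply_ne_zero_of_notMem_range
    {A : EuclideanSpace ℝ (Fin 2) →L[ℝ] EuclideanSpace ℝ (Fin 3)} (hA : Function.Injective A)
    {l : EuclideanSpace ℝ (Fin 3) →L[ℝ] ℝ} (hl : l ≠ 0) (hlA : ∀ u, l (A u) = 0)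
    {v : EuclideanSpace ℝ (Fin 3)} (hv : v ∉ range A) : l v ≠ 0 := by
  intro hlv
  have h1 : LinearMap.range A.toLinearMap ≤ LinearMap.ker l.toLinearMap := by
    rintro _ ⟨u, rfl⟩
    exact hlA u
  have h2 : Module.finrank ℝ (LinearMap.range A.toLinearMap) = 2 := by
    rw [LinearMap.finrank_range_of_inj hA]
    simp
  have h3 : Module.finrank ℝ (LinearMap.range l.toLinearMap) = 1 := by
    have hs : Function.Surjective l.toLinearMap := LinearMap.surjective (by
      intro h
      exact hl (ContinuousLinearMap.coe_injective h))
    rw [LinearMap.range_eq_top.2 hs]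
    simp
  have h4 := LinearMap.finrank_range_add_finrank_ker l.toLinearMap
  rw [h3, finrank_euclideanSpace, Fintype.card_fin] at h4
  have h5 := Submodule.eq_of_le_of_finrank_eq h1 (by omega)
  have h6 : v ∈ LinearMap.range A.toLinearMap := by
    rw [h5]
    exact hlv
  obtain ⟨u, hu⟩ := h6
  exact hv ⟨u, hu⟩

namespace LocalPicture

variable {h : Prop} {k : ℕ} {m : SheetModel h k} {i : F → M} {p : M} (c : LocalPicture m i p)

/-- The differential of the coordinates of a local picture, as a map to the model space. -/
noncomputable def dΦ (w : TangentBundle (𝓡∂ 3) M) : EuclideanSpace ℝ (Fin 3) :=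
  mfderiv (𝓡∂ 3) 𝓘(ℝ, EuclideanSpace ℝ (Fin 3)) c.Φ w.1 w.2

theorem continuousOn_dΦ [IsManifold (𝓡∂ 3) ∞ M] :
    ContinuousOn c.dΦ {w | w.1 ∈ c.S} := by
  have h1 : ContinuousOn (tangentMap (𝓡∂ 3) 𝓘(ℝ, EuclideanSpace ℝ (Fin 3)) c.Φ)
      {w | w.1 ∈ c.S} := by
    refine (c.contMDiffOn_Φ.continuousOn_tangentMapWithin (by simp)
      c.isOpen_S.uniqueMDiffOn).congr fun w hw => ?_
    rw [tangentMapWithin_eq_tangentMap (c.isOpen_S.uniqueMDiffOn _ hw) (c.mdifferentiableAt_Φ hw)]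
  exact continuous_snd.comp_continuousOn
    ((tangentBundleModelSpaceHomeomorph 𝓘(ℝ, EuclideanSpace ℝ (Fin 3))).continuous.comp_continuousOn
      h1)

theorem comp_mfderiv (hi : MDifferentiable (𝓡∂ 2) (𝓡∂ 3) i) {j : Fin k} {x : F}
    (hx : x ∈ c.Sh j) (u : TangentSpace (𝓡∂ 2) x) :
    c.dΦ ⟨i x, mfderiv (𝓡∂ 2) (𝓡∂ 3) i x u⟩ =
      m.D j (c.Ψ j x) (mfderiv (𝓡∂ 2) 𝓘(ℝ, EuclideanSpace ℝ (Fin 2)) (c.Ψ j) x u) := by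
  have h1 := (c.mdifferentiableAt_Φ (c.map_mem_S hx)).hasMFDerivAt.comp x (hi x).hasMFDerivAt
  have h2 := (m.hasFDerivAt j (c.Ψ j x)).hasMFDerivAt.comp x
    (c.mdifferentiableAt_Ψ j x hx).hasMFDerivAt
  have h3 : c.Φ ∘ i =ᶠ[𝓝 x] m.P j ∘ c.Ψ j := by
    filter_upwards [(c.isOpen_Sh j).mem_nhds hx] with y hy using c.Φ_i j y hy
  have h4 := hasMFDerivAt_unique h1 (h2.congr_of_eventuallyEq h3)
  exact DFunLike.congr_fun h4 u

theorem injective_mfderiv (hi : MDifferentiable (𝓡∂ 2) (𝓡∂ 3) i) {j : Fin k} {x : F}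
    (hx : x ∈ c.Sh j) (hQ : c.Ψ j x ∈ m.Q j) :
    Function.Injective (mfderiv (𝓡∂ 2) (𝓡∂ 3) i x) := by
  intro u w huw
  have h1 := c.comp_mfderiv hi hx u
  rw [huw, c.comp_mfderiv hi hx w] at h1
  exact (c.injective_Ψ j x hx (m.injective_D j _ hQ h1)).symm

theorem normal_ne_zero (hi : MDifferentiable (𝓡∂ 2) (𝓡∂ 3) i) {j : Fin k} {x : F}
    (hx : x ∈ c.Sh j) (hQ : c.Ψ j x ∈ m.Q j) {v : TangentSpace (𝓡∂ 3) (i x)}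
    (hv : v ∉ range (mfderiv (𝓡∂ 2) (𝓡∂ 3) i x)) : m.n j (c.Ψ j x) (c.dΦ ⟨i x, v⟩) ≠ 0 := by
  refine ContinuousLinearMap.apply_ne_zero_of_notMem_range
    (A := mfderiv (𝓡∂ 2) (𝓡∂ 3) i x) (c.injective_mfderiv hi hx hQ)
    (l := (m.n j (c.Ψ j x)).comp
      (mfderiv (𝓡∂ 3) 𝓘(ℝ, EuclideanSpace ℝ (Fin 3)) c.Φ (i x))) ?_ ?_ hv
  · intro h0
    refine m.n_ne_zero j _ hQ ?_
    ext1 w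
    obtain ⟨w', rfl⟩ := c.surjective_Φ _ (c.map_mem_S hx) w
    exact DFunLike.congr_fun h0 w'
  · intro u
    have h1 := c.comp_mfderiv hi hx u
    exact (congrArg (m.n j (c.Ψ j x)) h1).trans (m.n_D j _ _)

end LocalPicture

theorem IsPreconnected.exists_sign {X : Type*} [TopologicalSpace X] {s : Set X}
    (hs : IsPreconnected s) {f : X → ℝ} (hf : ContinuousOn f s) (h0 : ∀ x ∈ s, f x ≠ 0) :
    ∃ e : ℤ, (e = 1 ∨ e = -1) ∧ ∀ x ∈ s, 0 < e * f x := by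
  by_cases hpos : ∀ x ∈ s, 0 < f x
  · exact ⟨1, Or.inl rfl, fun x hx => by simpa using hpos x hx⟩
  · push Not at hpos
    obtain ⟨a, ha, hfa⟩ := hpos
    refine ⟨-1, Or.inr rfl, fun x hx => ?_⟩
    have : f x < 0 := by
      by_contra hfx
      rw [not_lt] at hfx
      obtain ⟨y, hy, hy0⟩ := hs.intermediate_value ha hx hf ⟨hfa, hfx⟩
      exact h0 y hy hy0
    simpa using this

/-- A curve passes through `i x` with velocity `ν x`. -/
def IsArrowCurve (i : F → M) (ν : ∀ x : F, TangentSpace (𝓡∂ 3) (i x)) (x : F) (γ : ℝ → M) :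
    Prop :=
  MDifferentiableAt 𝓘(ℝ, ℝ) (𝓡∂ 3) γ 0 ∧
    (⟨γ 0, mfderiv 𝓘(ℝ, ℝ) (𝓡∂ 3) γ 0 (1 : ℝ)⟩ : TangentBundle (𝓡∂ 3) M) = ⟨i x, ν x⟩

/-- An integer function is a winding number on `U` if it is locally constant on the complement of
the surface and increases by one along the arrows. -/
structure IsLocalWinding (i : F → M) (ν : ∀ x : F, TangentSpace (𝓡∂ 3) (i x)) (U : Set M)
    (f : M → ℤ) : Prop where
  eventually_eq : ∀ y ∈ U, y ∉ range i → ∀ᶠ z in 𝓝 y, f z = f y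
  jump : ∀ x, i x ∈ U → i x ∉ intersectionGraph i → ∀ γ, IsArrowCurve i ν x γ →
    ∃ n, (∀ᶠ t in 𝓝[>] (0 : ℝ), f (γ t) = n + 1) ∧ ∀ᶠ t in 𝓝[<] (0 : ℝ), f (γ t) = n

namespace LocalPicture

variable {h : Prop} {k : ℕ} {m : SheetModel h k} {i : F → M} {p : M} (c : LocalPicture m i p)
  {ν : ∀ x : F, TangentSpace (𝓡∂ 3) (i x)}

theorem hasDerivAt_comp_curve {x : F} (hx : i x ∈ c.S) {γ : ℝ → M} (hγ : IsArrowCurve i ν x γ) :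
    HasDerivAt (c.Φ ∘ γ) (c.dΦ ⟨i x, ν x⟩) 0 ∧ γ 0 = i x := by
  have h0 : γ 0 = i x := congrArg Bundle.TotalSpace.proj hγ.2
  refine ⟨?_, h0⟩
  have h1 := (c.mdifferentiableAt_Φ (h0 ▸ hx)).hasMFDerivAt.comp 0 hγ.1.hasMFDerivAt
  let L : ℝ →L[ℝ] EuclideanSpace ℝ (Fin 3) :=
    (mfderiv (𝓡∂ 3) 𝓘(ℝ, EuclideanSpace ℝ (Fin 3)) c.Φ (γ 0)).comp
      (mfderiv 𝓘(ℝ, ℝ) (𝓡∂ 3) γ 0)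
  have h2 : HasFDerivAt (c.Φ ∘ γ) L 0 := h1.hasFDerivAt
  rw [← hγ.2]
  exact h2.hasDerivAt

theorem exists_isLocalWinding [IsManifold (𝓡∂ 3) ∞ M]
    (c : LocalPicture m i p) (hi : MDifferentiable (𝓡∂ 2) (𝓡∂ 3) i)
    (hν : IsCoorientation i ν) : ∃ U f, IsOpen U ∧ p ∈ U ∧ IsLocalWinding i ν U f := by
  obtain ⟨ε, h0, h1, hεT⟩ := exists_openCube_subset (c.isOpen_T.mem_nhds c.zero_mem.1)
  -- Transversality keeps the normal component of `ν` nonzero and continuous on the immersed part of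
  -- the sheet; that part is connected, so the sign is constant there.
  have hsign : ∀ j, ∃ e : ℤ, (e = 1 ∨ e = -1) ∧ ∀ x ∈ c.Sh j, c.Ψ j x ∈ m.Q j →
      c.Φ (i x) ∈ openCube ε → 0 < e * m.n j (c.Ψ j x) (c.dΦ ⟨i x, ν x⟩) := by
    intro j
    set B := {q | q ∈ paramDomain h ∧ q ∈ m.Q j ∧ m.P j q ∈ openCube ε}
    have hpc : IsPreconnected (c.τ j '' B) := (m.preconnected j ε h0 h1).image _
      ((c.continuousOn_τ j).mono fun q hq => ⟨hq.1, hεT hq.2.2⟩)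
    have hmem : ∀ x, x ∈ c.τ j '' B ↔ x ∈ c.Sh j ∧ c.Ψ j x ∈ m.Q j ∧ c.Φ (i x) ∈ openCube ε := by
      intro x
      constructor
      · rintro ⟨q, hq, rfl⟩
        have hτ := c.τ_mem j q hq.1 (hεT hq.2.2)
        refine ⟨hτ, ?_, ?_⟩
        · rw [c.Ψ_τ j q hq.1 (hεT hq.2.2)]
          exact hq.2.1
        · rw [c.Φ_i j _ hτ, c.Ψ_τ j q hq.1 (hεT hq.2.2)]
          exact hq.2.2
      · rintro ⟨hx, hxQ, hxε⟩
        refine ⟨c.Ψ j x, ⟨c.Ψ_mem j x hx, hxQ, ?_⟩, c.τ_Ψ j x hx⟩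
        rwa [← c.Φ_i j x hx]
    have hcont : ContinuousOn (fun x => m.n j (c.Ψ j x) (c.dΦ ⟨i x, ν x⟩)) (c.τ j '' B) := by
      refine ContinuousOn.clm_apply ?_ ?_
      · refine (m.continuous_n j).comp_continuousOn fun x hx => ?_
        exact (c.mdifferentiableAt_Ψ j x ((hmem x).1 hx).1).continuousAt.continuousWithinAt
      · refine c.continuousOn_dΦ.comp (hν.continuousOn.mono fun x hx => ?_) fun x hx => ?_
        · exact c.injective_mfderiv hi ((hmem x).1 hx).1 ((hmem x).1 hx).2.1
        · exact c.map_mem_S ((hmem x).1 hx).1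
    obtain ⟨e, he, hpos⟩ := hpc.exists_sign hcont fun x hx => by
      obtain ⟨hx1, hx2, -⟩ := (hmem x).1 hx
      exact c.normal_ne_zero hi hx1 hx2 (hν.transverse x (c.injective_mfderiv hi hx1 hx2))
    exact ⟨e, he, fun x hx hxQ hxε => hpos x ((hmem x).2 ⟨hx, hxQ, hxε⟩)⟩
  choose e he hpos using hsign
  refine ⟨c.S ∩ c.Φ ⁻¹' openCube ε, fun y => m.step e (c.Φ y),
    c.contMDiffOn_Φ.continuousOn.isOpen_inter_preimage c.isOpen_S (isOpen_openCube ε),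
    ⟨c.mem_S, ?_⟩, ?_, ?_⟩
  · rw [mem_preimage, c.Φ_center]
    exact zero_mem_openCube h0
  · rintro y ⟨hyS, -⟩ hy
    exact (c.continuousAt_Φ hyS).eventually (m.step_eventually e _ (c.Φ_mem y hyS).2
      fun j q hq hqy => hy (c.mem_range_of_eq hyS hq hqy))
  · rintro x ⟨hxS, hxε⟩ hxg γ hγ
    obtain ⟨j, hj⟩ := c.exists_mem_Sh hxS
    obtain ⟨hd, hγ0⟩ := c.hasDerivAt_comp_curve hxS hγ
    have hP := c.Φ_i j x hj
    have hq := c.Ψ_mem j x hj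
    have hnd : m.P j (c.Ψ j x) ∉ closure (doubleValues h m.P) := fun hmem =>
      hxg (c.mem_intersectionGraph hxS (hP ▸ hmem))
    exact m.step_jump e he j _ hq (hP ▸ (c.Φ_mem _ hxS).2) hnd _ _ hd
      ((congrArg c.Φ hγ0).trans hP) (hpos j x hj (m.mem_Q j _ hq hnd) hxε)

end LocalPicture

/-! ### Uniqueness of local winding numbers up to constants -/

theorem IsGenericSurface.dense_compl_range {i : F → M} (hi : IsGenericSurface i) :
    Dense (range i)ᶜ := by
  intro p
  by_cases hp : p ∈ range i
  · obtain ⟨⟨h, k, m, ⟨c⟩⟩, -⟩ := hi.exists_localPicture hp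
    exact c.mem_closure_compl_range
  · exact subset_closure hp

theorem IsLocalWinding.mono {F : Type v} {i : F → M} {ν : ∀ x : F, TangentSpace (𝓡∂ 3) (i x)} {U V : Set M}
    {f : M → ℤ} (hf : IsLocalWinding i ν U f) (hVU : V ⊆ U) : IsLocalWinding i ν V f :=
  ⟨fun y hy => hf.eventually_eq y (hVU hy), fun x hx => hf.jump x (hVU hx)⟩

namespace LocalPicture

section

variable {h : Prop} {k : ℕ} {m : SheetModel h k} {i : F → M} {p : M} (c : LocalPicture m i p)
  {ν : ∀ x : F, TangentSpace (𝓡∂ 3) (i x)}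

theorem mdifferentiableAt_σ {v : EuclideanSpace ℝ (Fin 3)} (hv : v ∈ c.T ∩ modelDomain h)
    (hv0 : h → 0 < v 0) : MDifferentiableAt 𝓘(ℝ, EuclideanSpace ℝ (Fin 3)) (𝓡∂ 3) c.σ v := by
  refine (c.contMDiffOn_σ.mdifferentiableOn (by simp) v hv).mdifferentiableAt
    (inter_mem (c.isOpen_T.mem_nhds hv.1) ?_)
  by_cases hh : h
  · have hc : Continuous fun v : EuclideanSpace ℝ (Fin 3) => v 0 := by fun_prop
    filter_upwards [continuousAt_const.eventually_lt hc.continuousAt (hv0 hh)] with w hw _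
    exact hw.le
  · filter_upwards with w hh' using absurd hh' hh

/-- The curve is a straight line in coordinates. Positivity of the first coordinate, when the model
is a half-space, keeps the line inside the model on both sides of time zero; at a boundary point an
arrow may have no such two-sided curve. -/
theorem exists_isArrowCurve {x : F} (hx : i x ∈ c.S) (hx0 : h → 0 < c.Φ (i x) 0) :
    ∃ γ, IsArrowCurve i ν x γ := by
  set v := c.Φ (i x)
  set w := c.dΦ ⟨i x, ν x⟩
  have hv := c.Φ_mem _ hx
  have hσv : c.σ v = i x := c.σ_Φ _ hx
  have hl : HasFDerivAt (fun t : ℝ => v + t • w)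
      ((1 : ℝ →L[ℝ] ℝ).smulRight w) 0 := by
    have := ((1 : ℝ →L[ℝ] ℝ).smulRight w).hasFDerivAt (x := (0 : ℝ)).const_add v
    simpa using this
  have hl0 : v + (0 : ℝ) • w = v := by simp
  have h1 := (hl0.symm ▸ c.mdifferentiableAt_σ hv hx0 :
    MDifferentiableAt 𝓘(ℝ, EuclideanSpace ℝ (Fin 3)) (𝓡∂ 3) c.σ (v + (0 : ℝ) • w)).hasMFDerivAt.comp
    (0 : ℝ) hl.hasMFDerivAt
  refine ⟨fun t => c.σ (v + t • w), h1.mdifferentiableAt, ?_⟩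
  have h2 : HasMFDerivAt (𝓡∂ 3) (𝓡∂ 3) (c.σ ∘ c.Φ) (i x) _ :=
    (c.mdifferentiableAt_σ hv hx0).hasMFDerivAt.comp (i x) (c.mdifferentiableAt_Φ hx).hasMFDerivAt
  have h3 : id =ᶠ[𝓝 (i x)] c.σ ∘ c.Φ := by
    filter_upwards [c.isOpen_S.mem_nhds hx] with y hy using (c.σ_Φ y hy).symm
  have h4 := hasMFDerivAt_unique (h2.congr_of_eventuallyEq h3) (hasMFDerivAt_id (i x))
  have h5 : mfderiv 𝓘(ℝ, EuclideanSpace ℝ (Fin 3)) (𝓡∂ 3) c.σ v w = ν x :=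
    DFunLike.congr_fun h4 (ν x)
  have h6 : mfderiv 𝓘(ℝ, ℝ) (𝓡∂ 3) (fun t : ℝ => c.σ (v + t • w)) 0 (1 : ℝ) =
      mfderiv 𝓘(ℝ, EuclideanSpace ℝ (Fin 3)) (𝓡∂ 3) c.σ (v + (0 : ℝ) • w) ((1 : ℝ) • w) :=
    DFunLike.congr_fun h1.mfderiv (1 : ℝ)
  have h7 : ∀ v' w', v' = v → w' = w → (⟨c.σ v',
      mfderiv 𝓘(ℝ, EuclideanSpace ℝ (Fin 3)) (𝓡∂ 3) c.σ v' w'⟩ : TangentBundle (𝓡∂ 3) M) =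
      ⟨i x, ν x⟩ := by
    rintro _ _ rfl rfl
    exact Bundle.TotalSpace.ext hσv (heq_of_eq h5)
  rw [h6]
  exact h7 _ _ hl0 (one_smul _ _)

end

/-- Near a regular value through which an arrow curve passes, any two winding numbers differ by a
constant. -/
theorem eventually_sub_eq_of_regular [IsManifold (𝓡∂ 3) ∞ M] {h : Prop} {i : F → M} {x : F}
    {ν : ∀ x : F, TangentSpace (𝓡∂ 3) (i x)} (c : LocalPicture (singleModel h) i (i x))
    (hi : MDifferentiable (𝓡∂ 2) (𝓡∂ 3) i) (hν : IsCoorientation i ν)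
    (hx : i x ∉ intersectionGraph i) {U : Set M} (hU : U ∈ 𝓝 (i x)) {f g : M → ℤ}
    (hf : IsLocalWinding i ν U f) (hg : IsLocalWinding i ν U g) {γ : ℝ → M}
    (hγ : IsArrowCurve i ν x γ) : ∃ n, ∀ᶠ y in 𝓝[(range i)ᶜ] (i x), f y - g y = n := by
  obtain ⟨ε, hε0, -, hεT, hεU⟩ := c.exists_cube hU
  have hplane : ∀ j q, (singleModel h).P j q 2 = 0 := fun j q => by
    fin_cases j
    simp [singleModel, planeModel, planeXYL_apply, planeXY]
  have hoff : ∀ v ∈ openCube ε ∩ modelDomain h, v 2 ≠ 0 → c.σ v ∉ range i := by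
    rintro v hv hv2 ⟨x', hx'⟩
    have hvT : v ∈ c.T ∩ modelDomain h := ⟨hεT hv.1, hv.2⟩
    obtain ⟨j, hj⟩ := c.exists_mem_Sh (hx' ▸ c.σ_mem v hvT)
    refine hv2 ?_
    rw [← c.Φ_σ v hvT, ← hx', c.Φ_i j x' hj, hplane]
  -- The plane cuts the cube into convex halves off the surface, and `f - g` is locally constant on
  -- each of them.
  have hside : ∀ B : Set (EuclideanSpace ℝ (Fin 3)), Convex ℝ B → (∀ v ∈ B, v 2 ≠ 0) →
      ∀ v ∈ openCube ε ∩ modelDomain h ∩ B, ∀ w ∈ openCube ε ∩ modelDomain h ∩ B,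
      f (c.σ v) - g (c.σ v) = f (c.σ w) - g (c.σ w) := by
    intro B hB hB2 v hv w hw
    have hpre : IsPreconnected (openCube ε ∩ modelDomain h ∩ B) :=
      (((convex_openCube ε).inter (convex_modelDomain h)).inter hB).isPreconnected
    refine hpre.constant (f := fun v => f (c.σ v) - g (c.σ v)) (fun z hz => ?_) hv hw
    have hzr := hoff z hz.1 (hB2 z hz.2)
    have hzU := hεU z hz.1
    have hσ : ContinuousWithinAt c.σ (openCube ε ∩ modelDomain h ∩ B) z :=
      (c.continuousWithinAt_σ ⟨hεT hz.1.1, hz.1.2⟩).mono fun w hw => ⟨hεT hw.1.1, hw.1.2⟩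
    have hev : ∀ᶠ y in 𝓝 (c.σ z), f y - g y = f (c.σ z) - g (c.σ z) := by
      filter_upwards [hf.eventually_eq _ hzU hzr, hg.eventually_eq _ hzU hzr] with y h1 h2
      rw [h1, h2]
    exact tendsto_const_nhds.congr' ((hσ.eventually hev).mono fun w hw => hw.symm)
  obtain ⟨j, hj⟩ := c.exists_mem_Sh c.mem_S
  obtain ⟨hd, hγ0⟩ := c.hasDerivAt_comp_curve c.mem_S hγ
  have hQ : c.Ψ j x ∈ (singleModel h).Q j := mem_univ _
  have hne : c.dΦ ⟨i x, ν x⟩ 2 ≠ 0 := by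
    have h1 := c.normal_ne_zero hi hj hQ (hν.transverse x (c.injective_mfderiv hi hj hQ))
    fin_cases j
    exact h1
  have hmem : ∀ᶠ t in 𝓝 (0 : ℝ), γ t ∈ c.S ∧ c.Φ (γ t) ∈ openCube ε := by
    have hγc : ContinuousAt γ 0 := hγ.1.continuousAt
    refine (hγc.eventually_mem (hγ0.symm ▸ c.isOpen_S.mem_nhds c.mem_S)).and
      (hd.continuousAt.eventually_mem ((isOpen_openCube ε).mem_nhds ?_))
    rw [Function.comp_apply, hγ0, c.Φ_center]
    exact zero_mem_openCube hε0
  -- Both functions gain one along the same curve, so their difference is `a - b` before and after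
  -- the crossing. Nonzero normal velocity puts these two times in opposite halves.
  obtain ⟨a, hfa, hfa'⟩ := hf.jump x (mem_of_mem_nhds hU) hx γ hγ
  obtain ⟨b, hgb, hgb'⟩ := hg.jump x (mem_of_mem_nhds hU) hx γ hγ
  have hz0 : c.Φ (γ 0) 2 = 0 := by rw [hγ0, c.Φ_center]; rfl
  have hpt : ∀ t, γ t ∈ c.S → c.Φ (γ t) ∈ openCube ε → f (γ t) - g (γ t) = a - b →
      c.Φ (γ t) ∈ openCube ε ∩ modelDomain h ∧
        f (c.σ (c.Φ (γ t))) - g (c.σ (c.Φ (γ t))) = a - b := fun t ht ht' hab =>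
    ⟨⟨ht', (c.Φ_mem _ ht).2⟩, by rw [c.σ_Φ _ ht]; exact hab⟩
  have hR : ∃ t, γ t ∈ c.S ∧ c.Φ (γ t) ∈ openCube ε ∧ f (γ t) - g (γ t) = a - b ∧
      0 < c.dΦ ⟨i x, ν x⟩ 2 * c.Φ (γ t) 2 := by
    have h1 := ((hd.euclidean_apply 2).const_mul (c.dΦ ⟨i x, ν x⟩ 2)).eventually_pos_neg
      (by simp [hz0]) (mul_self_pos.2 hne)
    obtain ⟨t, h1, h2, h3, h4⟩ := (h1.1.and (hfa.and (hgb.and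
      (mem_nhdsWithin_of_mem_nhds hmem)))).exists
    exact ⟨t, h4.1, h4.2, by rw [h2, h3]; ring, h1⟩
  have hL : ∃ t, γ t ∈ c.S ∧ c.Φ (γ t) ∈ openCube ε ∧ f (γ t) - g (γ t) = a - b ∧
      c.dΦ ⟨i x, ν x⟩ 2 * c.Φ (γ t) 2 < 0 := by
    have h1 := ((hd.euclidean_apply 2).const_mul (c.dΦ ⟨i x, ν x⟩ 2)).eventually_pos_neg
      (by simp [hz0]) (mul_self_pos.2 hne)
    obtain ⟨t, h1, h2, h3, h4⟩ := (h1.2.and (hfa'.and (hgb'.and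
      (mem_nhdsWithin_of_mem_nhds hmem)))).exists
    exact ⟨t, h4.1, h4.2, by rw [h2, h3], h1⟩
  obtain ⟨r, hr, hr', hr2, hr3⟩ := hR
  obtain ⟨l, hl, hl', hl2, hl3⟩ := hL
  refine ⟨a - b, ?_⟩
  have hcube : ∀ᶠ y in 𝓝 (i x), c.Φ y ∈ openCube ε :=
    (c.continuousAt_Φ c.mem_S).eventually_mem ((isOpen_openCube ε).mem_nhds
      (c.Φ_center.symm ▸ zero_mem_openCube hε0))
  filter_upwards [mem_nhdsWithin_of_mem_nhds hcube,
    mem_nhdsWithin_of_mem_nhds (c.isOpen_S.mem_nhds c.mem_S), self_mem_nhdsWithin]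
    with y hy hyS hyr
  have hlin : IsLinearMap ℝ fun v : EuclideanSpace ℝ (Fin 3) => c.dΦ ⟨i x, ν x⟩ 2 * v 2 :=
    ⟨fun v w => by simp [mul_add], fun s v => by simp; ring⟩
  have hy2 : c.dΦ ⟨i x, ν x⟩ 2 * c.Φ y 2 ≠ 0 := by
    refine mul_ne_zero hne fun h2 => hyr ?_
    obtain ⟨q, hq⟩ := exists_planeXY_eq h2
    refine c.mem_range_of_eq hyS (j := 0) (q := q) (fun hh => ?_) hq
    have h3 : c.Φ y 0 = q 0 := by rw [← hq]; simp [planeXY]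
    rw [← h3]
    exact (c.Φ_mem y hyS).2 hh
  rw [← c.σ_Φ y hyS]
  rcases hy2.lt_or_gt with h3 | h3
  · obtain ⟨h4, h5⟩ := hpt l hl hl' hl2
    rw [← h5]
    refine hside {v | c.dΦ ⟨i x, ν x⟩ 2 * v 2 < 0} (convex_halfSpace_lt hlin 0) ?_ _
      ⟨⟨hy, (c.Φ_mem y hyS).2⟩, h3⟩ _ ⟨h4, hl3⟩
    intro v hv hv2
    simp [hv2] at hv
  · obtain ⟨h4, h5⟩ := hpt r hr hr' hr2
    rw [← h5]
    refine hside {v | 0 < c.dΦ ⟨i x, ν x⟩ 2 * v 2} (convex_halfSpace_gt hlin 0) ?_ _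
      ⟨⟨hy, (c.Φ_mem y hyS).2⟩, h3⟩ _ ⟨h4, hr3⟩
    intro v hv hv2
    simp [hv2] at hv

end LocalPicture

/-- The part of an open cube that lies in the interior of the model domain, off the axes. -/
def openCubeOffAxes (h : Prop) (ε : ℝ) : Set (EuclideanSpace ℝ (Fin 3)) :=
  {v | v ∈ openCube ε ∧ (h → 0 < v 0) ∧ v ∉ coordAxes}

/-- If two coordinates of a point of the segment vanish, then so does their difference `t * (b a - b
a')`. Distinctness of the coordinates of `b` forces `t = 0`, but the endpoint `(α, α, α)` is off the
axes. -/
theorem segment_subset_openCubeOffAxes {h : Prop} {ε α : ℝ} (hα : 0 < α) (hαε : α < ε)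
    {b : EuclideanSpace ℝ (Fin 3)} (hb : b ∈ openCube ε) (hb0 : h → 0 < b 0)
    (hbd : Function.Injective b.ofLp) :
    segment ℝ !₂[α, α, α] b ⊆ openCubeOffAxes h ε := by
  have hαa : ∀ a, (!₂[α, α, α] : EuclideanSpace ℝ (Fin 3)) a = α := fun a => by
    fin_cases a <;> rfl
  generalize (!₂[α, α, α] : EuclideanSpace ℝ (Fin 3)) = w at hαa ⊢
  rintro _ ⟨s, t, hs, ht, hst, rfl⟩
  refine ⟨convex_openCube ε (fun a => ?_) hb hs ht hst, fun hh => ?_, ?_⟩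
  · rwa [hαa, abs_of_pos hα]
  · have h1 := hb0 hh
    simp only [PiLp.add_apply, PiLp.smul_apply, smul_eq_mul, hαa]
    rcases hs.eq_or_lt with rfl | hs
    · simp only [zero_add] at hst
      simp [hst, h1]
    · positivity
  · rintro ⟨a, a', hne, h1, h2⟩
    simp only [PiLp.add_apply, PiLp.smul_apply, smul_eq_mul, hαa] at h1 h2
    have h3 : t * (b a - b a') = 0 := by linarith
    rcases mul_eq_zero.1 h3 with h4 | h4
    · rw [h4, add_zero] at hst
      rw [h4, hst] at h1
      linarith
    · exact hne (hbd (sub_eq_zero.1 h4))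

/-- Move `v` slightly towards a point of the cube with distinct positive coordinates: unequal
coordinates stay unequal by continuity, and equal ones separate at once. -/
theorem exists_injective_near {h : Prop} {ε : ℝ} (hε : 0 < ε) {v : EuclideanSpace ℝ (Fin 3)}
    (hv : v ∈ openCube ε ∩ modelDomain h) {W : Set (EuclideanSpace ℝ (Fin 3))}
    (hW : W ∈ 𝓝 v) : ∃ b ∈ W, b ∈ openCube ε ∧ (h → 0 < b 0) ∧ Function.Injective b.ofLp := by
  set e : EuclideanSpace ℝ (Fin 3) := !₂[ε / 4, ε / 2, 3 * ε / 4]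
  have he : e ∈ openCube ε := by
    intro a
    rw [abs_lt]
    fin_cases a <;> simp [e] <;> constructor <;> linarith
  have hinj : ∀ a a', a ≠ a' → e a ≠ e a' := by
    intro a a'
    fin_cases a <;> fin_cases a' <;> simp [e] <;> intro h0 <;> linarith
  have hc : Tendsto (fun δ : ℝ => (1 - δ) • v + δ • e) (𝓝 0) (𝓝 v) := by
    have : Continuous fun δ : ℝ => (1 - δ) • v + δ • e := by fun_prop
    simpa using this.tendsto 0
  have h1 : ∀ a a', a ≠ a' → ∀ᶠ δ in 𝓝[>] (0 : ℝ),
      ((1 - δ) • v + δ • e) a ≠ ((1 - δ) • v + δ • e) a' := by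
    intro a a' hne
    by_cases hva : v a = v a'
    · filter_upwards [self_mem_nhdsWithin] with δ hδ h0
      simp only [PiLp.add_apply, PiLp.smul_apply, smul_eq_mul, hva] at h0
      exact hinj a a' hne (mul_left_cancel₀ (ne_of_gt hδ) (add_left_cancel h0))
    · have h2 : Tendsto (fun δ : ℝ => ((1 - δ) • v + δ • e) a - ((1 - δ) • v + δ • e) a')
          (𝓝 0) (𝓝 (v a - v a')) :=
        (((EuclideanSpace.proj (𝕜 := ℝ) a).continuous.tendsto v).comp hc).sub
          (((EuclideanSpace.proj (𝕜 := ℝ) a').continuous.tendsto v).comp hc)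
      filter_upwards [mem_nhdsWithin_of_mem_nhds (h2.eventually_ne (sub_ne_zero.2 hva))] with δ hδ
      exact sub_ne_zero.1 hδ
  have h2 : ∀ᶠ δ in 𝓝[>] (0 : ℝ), ∀ a a', a ≠ a' →
      ((1 - δ) • v + δ • e) a ≠ ((1 - δ) • v + δ • e) a' := by
    simp only [eventually_all]
    exact fun a a' hne => h1 a a' hne
  have h3 : ∀ᶠ δ in 𝓝[>] (0 : ℝ), (1 - δ) • v + δ • e ∈ W := mem_nhdsWithin_of_mem_nhds (hc hW)
  have h4 : ∀ᶠ δ in 𝓝[>] (0 : ℝ), δ < 1 := mem_nhdsWithin_of_mem_nhds (gt_mem_nhds one_pos)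
  have h5 : ∀ᶠ δ in 𝓝[>] (0 : ℝ), 0 < δ := self_mem_nhdsWithin
  obtain ⟨δ, hδi, hδW, hδ1, hδ0⟩ := (h2.and (h3.and (h4.and h5))).exists
  refine ⟨_, hδW, convex_openCube ε hv.1 he (by linarith) hδ0.le (by ring), fun hh => ?_,
    fun a a' haa => ?_⟩
  · have h3 := hv.2 hh
    have h4 : 0 ≤ (1 - δ) * v 0 := mul_nonneg (by linarith) h3
    have h5 : 0 < δ * e 0 := by simp only [e]; simp; positivity
    simpa using add_pos_of_nonneg_of_pos h4 h5
  · by_contra hne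
    exact hδi a a' hne haa

/-- Near each value of a generic surface, any two winding numbers differ by a constant. -/
theorem IsGenericSurface.eventually_sub_eq [IsManifold (𝓡∂ 3) ∞ M] {i : F → M}
    (hi : IsGenericSurface i) {ν : ∀ x : F, TangentSpace (𝓡∂ 3) (i x)}
    (hν : IsCoorientation i ν) {p : M} {U : Set M} (hUo : IsOpen U) (hpU : p ∈ U) {f g : M → ℤ}
    (hf : IsLocalWinding i ν U f) (hg : IsLocalWinding i ν U g) :
    ∃ n, ∀ᶠ y in 𝓝[(range i)ᶜ] p, f y - g y = n := by
  have hoff : ∀ y ∈ U, y ∉ range i → ∀ᶠ z in 𝓝 y, f z - g z = f y - g y := by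
    intro y hyU hy
    filter_upwards [hf.eventually_eq y hyU hy, hg.eventually_eq y hyU hy] with z h1 h2
    rw [h1, h2]
  by_cases hp : p ∈ range i
  swap
  · exact ⟨_, mem_nhdsWithin_of_mem_nhds (hoff p hpU hp)⟩
  have himd : MDifferentiable (𝓡∂ 2) (𝓡∂ 3) i := hi.smooth.mdifferentiable (by simp)
  obtain ⟨⟨h, k, m, ⟨c⟩⟩, -⟩ := hi.exists_localPicture hp
  obtain ⟨ε, hε0, -, hεT, hεU⟩ := c.exists_cube (hUo.mem_nhds hpU)
  have hT : ∀ v ∈ openCubeOffAxes h ε, v ∈ c.T ∩ modelDomain h := fun v hv =>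
    ⟨hεT hv.1, fun hh => (hv.2.1 hh).le⟩
  have hσU : ∀ v ∈ openCubeOffAxes h ε, c.σ v ∈ U := fun v hv => hεU v ⟨hv.1, (hT v hv).2⟩
  -- Off the axes and in the interior of the model domain, a surface point is regular and has an
  -- arrow curve, so the single-sheet case applies even where `v` lies on the surface.
  have hex : ∀ v ∈ openCubeOffAxes h ε,
      ∃ n, ∀ᶠ y in 𝓝[(range i)ᶜ] (c.σ v), f y - g y = n := by
    intro v hv
    by_cases hvr : c.σ v ∈ range i
    · obtain ⟨x, hx⟩ := hvr
      have hxS : i x ∈ c.S := hx ▸ c.σ_mem v (hT v hv)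
      have hΦx : c.Φ (i x) = v := by rw [hx, c.Φ_σ v (hT v hv)]
      have hxg : i x ∉ intersectionGraph i :=
        c.notMem_intersectionGraph hxS (hΦx.symm ▸ hv.2.2)
      obtain ⟨h', ⟨c'⟩⟩ := (hi.exists_localPicture (mem_range_self x)).2 hxg
      obtain ⟨γ, hγ⟩ := c.exists_isArrowCurve (ν := ν) hxS (hΦx.symm ▸ hv.2.1)
      rw [← hx]
      exact c'.eventually_sub_eq_of_regular himd hν hxg
        (hUo.mem_nhds (hx ▸ hσU v hv)) hf hg hγ
    · exact ⟨_, mem_nhdsWithin_of_mem_nhds (hoff _ (hσU v hv) hvr)⟩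
  choose! κ hκ using hex
  have huniq : ∀ v ∈ openCubeOffAxes h ε, ∀ n,
      (∀ᶠ y in 𝓝[(range i)ᶜ] (c.σ v), f y - g y = n) → κ v = n := by
    intro v hv n hn
    have := mem_closure_iff_nhdsWithin_neBot.1 (hi.dense_compl_range (c.σ v))
    obtain ⟨y, h1, h2⟩ := ((hκ v hv).and hn).exists
    exact h1.symm.trans h2
  -- The constant valid near one point serves at all nearby points, by uniqueness of germs on the
  -- dense complement; hence `κ` is locally constant.
  have hκc : ContinuousOn κ (openCubeOffAxes h ε) := by
    intro v hv
    have h1 := eventually_eventually_nhds.2 (eventually_nhdsWithin_iff.1 (hκ v hv))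
    have h2 : ContinuousWithinAt c.σ (openCubeOffAxes h ε) v :=
      (c.continuousWithinAt_σ (hT v hv)).mono hT
    refine tendsto_const_nhds.congr' ?_
    filter_upwards [h2.eventually h1, self_mem_nhdsWithin] with w hw hwG
    exact (huniq w hwG _ (eventually_nhdsWithin_iff.2 hw)).symm
  set a : EuclideanSpace ℝ (Fin 3) := !₂[ε / 2, ε / 2, ε / 2]
  refine ⟨κ a, ?_⟩
  have hcube : ∀ᶠ y in 𝓝 p, c.Φ y ∈ openCube ε :=
    (c.continuousAt_Φ c.mem_S).eventually_mem ((isOpen_openCube ε).mem_nhds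
      (c.Φ_center.symm ▸ zero_mem_openCube hε0))
  filter_upwards [mem_nhdsWithin_of_mem_nhds hcube, mem_nhdsWithin_of_mem_nhds
    (c.isOpen_S.mem_nhds c.mem_S), mem_nhdsWithin_of_mem_nhds (hUo.mem_nhds hpU),
    self_mem_nhdsWithin] with y hy hyS hyU hyr
  have hyT := c.Φ_mem y hyS
  have h1 : ∀ᶠ v in 𝓝[c.T ∩ modelDomain h] (c.Φ y),
      ∀ᶠ z in 𝓝 (c.σ v), f z - g z = f y - g y := by
    have h2 : ∀ᶠ y' in 𝓝 (c.σ (c.Φ y)), ∀ᶠ z in 𝓝 y', f z - g z = f y - g y := by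
      rw [c.σ_Φ y hyS]
      exact eventually_eventually_nhds.2 (hoff y hyU hyr)
    exact (c.continuousWithinAt_σ hyT).eventually h2
  obtain ⟨W, hW, hWs⟩ := mem_nhdsWithin_iff_exists_mem_nhds_inter.1 h1
  -- The point `Φ y` itself may lie on an axis or on the boundary. It is replaced by a nearby `b`,
  -- with the same difference `f - g`, that a segment joins to `a` within the good region.
  obtain ⟨b, hbW, hbε, hb0, hbi⟩ := exists_injective_near hε0 ⟨hy, hyT.2⟩ hW
  have hseg := segment_subset_openCubeOffAxes (half_pos hε0) (half_lt_self hε0) hbε hb0 hbi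
  have h2 : κ a = κ b := (convex_segment a b).isPreconnected.constant (hκc.mono hseg)
    (left_mem_segment ℝ a b) (right_mem_segment ℝ a b)
  have hbG := hseg (right_mem_segment ℝ a b)
  rw [h2]
  exact (huniq b hbG _ (mem_nhdsWithin_of_mem_nhds (hWs ⟨hbW, hT b hbG⟩))).symm

/-! ### The global winding function -/

/-- Around each point of the manifold there is a winding number. -/
theorem IsGenericSurface.exists_isLocalWinding [T2Space M] [CompactSpace F]
    [IsManifold (𝓡∂ 3) ∞ M] {i : F → M} (hi : IsGenericSurface i)
    {ν : ∀ x : F, TangentSpace (𝓡∂ 3) (i x)} (hν : IsCoorientation i ν) (p : M) :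
    ∃ U f, IsOpen U ∧ p ∈ U ∧ IsLocalWinding i ν U f := by
  by_cases hp : p ∈ range i
  · obtain ⟨⟨h, k, m, ⟨c⟩⟩, -⟩ := hi.exists_localPicture hp
    exact c.exists_isLocalWinding (hi.smooth.mdifferentiable (by simp)) hν
  · refine ⟨(range i)ᶜ, fun _ => 0, ?_, hp, ?_⟩
    · exact (isCompact_range hi.smooth.continuous).isClosed.isOpen_compl
    · exact ⟨fun y _ _ => Eventually.of_forall fun _ => rfl,
        fun x hx => absurd (mem_range_self x) hx⟩

/-- A generic surface with a co-orientation has a function that restricts, near each point, to a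
winding number. -/
theorem IsGenericSurface.exists_winding [T2Space M] [CompactSpace F] [ConnectedSpace M]
    [IsManifold (𝓡∂ 3) ∞ M] (hM : HasPeriodicH1 M) {i : F → M} (hi : IsGenericSurface i)
    {ν : ∀ x : F, TangentSpace (𝓡∂ 3) (i x)} (hν : IsCoorientation i ν) :
    ∃ w : M → ℤ, ∀ p, ∃ U f n, IsOpen U ∧ p ∈ U ∧ IsLocalWinding i ν U f ∧
      ∀ᶠ y in 𝓝[(range i)ᶜ] p, w y = f y + n := by
  have : LocallyPathConnectedSpace M := ChartedSpace.locallyPathConnectedSpace (EuclideanHalfSpace 3) M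
  have : PathConnectedSpace M := pathConnectedSpace_iff_connectedSpace.2 inferInstance
  choose U f hU hp hf using hi.exists_isLocalWinding hν
  obtain ⟨w, hw⟩ := exists_glued_function hM hi.dense_compl_range U f hU hp
    fun p q x hx => hi.eventually_sub_eq hν ((hU p).inter (hU q)) hx
      ((hf p).mono inter_subset_left) ((hf q).mono inter_subset_right)
  exact ⟨w, fun p => ⟨U p, f p, (hw p).choose, hU p, hp p, hf p, (hw p).choose_spec⟩⟩

end LocalPictures

theorem lemma2p10
    {M : Type u} [TopologicalSpace M] [T2Space M] [SecondCountableTopology M]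
    [ChartedSpace (EuclideanHalfSpace 3) M] [IsManifold (𝓡∂ 3) ∞ M]
    {F : Type v} [TopologicalSpace F] [T2Space F] [CompactSpace F]
    [ChartedSpace (EuclideanHalfSpace 2) F] [IsManifold (𝓡∂ 2) ∞ F]
    (hconn : ConnectedSpace M) (horient : IsOrientable3 M) (hper : HasPeriodicH1 M)
    (i : F → M) (hi : IsGenericSurface i)
    (ν : ∀ x : F, TangentSpace (𝓡∂ 3) (i x)) (hν : IsCoorientation i ν) :
    ∃ w : {U : Set M // IsBody i U} → ℤ, IsWindingNumbers i ν w := by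
  obtain ⟨w, hw⟩ := hi.exists_winding hper hν
  have hopen : IsOpen (range i)ᶜ := (isCompact_range hi.smooth.continuous).isClosed.isOpen_compl
  -- Off the surface `w` is a local winding number plus a constant, so it is locally constant and
  -- therefore constant on each body.
  have hlc : ContinuousOn w (range i)ᶜ := by
    intro y hy
    obtain ⟨U, f, n, hU, hyU, hf, hwf⟩ := hw y
    have h1 : ∀ᶠ z in 𝓝[(range i)ᶜ] y, w z = w y := by
      filter_upwards [hwf, mem_nhdsWithin_of_mem_nhds (hf.eventually_eq y hyU hy)] with z h1 h2
      rw [h1, h2, hwf.self_of_nhdsWithin hy]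
    exact tendsto_const_nhds.congr' (h1.mono fun z hz => hz.symm)
  have hbody : ∀ (U : {U : Set M // IsBody i U}), ∀ y ∈ U.1, y ∈ (range i)ᶜ ∧
      w y = w U.2.choose := by
    intro U y hy
    obtain ⟨hq, hUq⟩ := U.2.choose_spec
    have hsub : U.1 ⊆ (range i)ᶜ := by
      rw [hUq]
      exact connectedComponentIn_subset _ _
    refine ⟨hsub hy, IsPreconnected.constant ?_ (hlc.mono hsub) hy ?_⟩
    · rw [hUq]
      exact isPreconnected_connectedComponentIn
    · have h1 := mem_connectedComponentIn hq
      rwa [← hUq] at h1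
  refine ⟨fun U => w U.2.choose, ?_⟩
  rintro V U₁ U₂ ⟨p, hp, rfl⟩ ⟨x, hxV, γ, hγ, hγν, hγ₁, hγ₂⟩
  have hx : i x ∉ intersectionGraph i := (connectedComponentIn_subset _ _ hxV).2
  obtain ⟨U, f, n, hU, hxU, hf, hwf⟩ := hw (i x)
  obtain ⟨a, ha₁, ha₂⟩ := hf.jump x hxU hx γ ⟨hγ, hγν⟩
  have hγ0 : γ 0 = i x := congrArg Bundle.TotalSpace.proj hγν
  -- The formula `w = f + n` holds only off the surface; the points of the curve at which it is used
  -- lie in bodies.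
  have hwγ : ∀ᶠ t in 𝓝 (0 : ℝ), γ t ∈ (range i)ᶜ → w (γ t) = f (γ t) + n := by
    have := eventually_nhdsWithin_iff.1 hwf
    rw [← hγ0] at this
    exact hγ.continuousAt.eventually this
  obtain ⟨t, ht₁, ht₂, ht₃⟩ := (hγ₁.and (ha₁.and (mem_nhdsWithin_of_mem_nhds hwγ))).exists
  obtain ⟨s, hs₁, hs₂, hs₃⟩ := (hγ₂.and (ha₂.and (mem_nhdsWithin_of_mem_nhds hwγ))).exists
  obtain ⟨ht₄, ht₅⟩ := hbody U₁ _ ht₁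
  obtain ⟨hs₄, hs₅⟩ := hbody U₂ _ hs₁
  have e1 := ht₃ ht₄
  have e2 := hs₃ hs₄
  show w U₁.2.choose = w U₂.2.choose + 1
  rw [← ht₅, ← hs₅, e1, e2, ht₂, hs₂]
  ring
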